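/- Let $K$ be a $p$-adic field (a non-archimedean local field of characteristic $0$) with valuation ring $R$, uniformizer $\pi$, residue field of order $q$, normalized valuation $v=v_\pi$ (with $v(0)=\infty$) and absolute value $|a|=q^{-v(a)}$. Let $\ell=v(2)$. For $f\in R[x_1,\dots,x_n]$ the Igusa local zeta function is $Z_f(s)=\int_{R^n}|f(x)|^s\,dx$ for $\operatorname{Re}(s)>0$, with Haar measure of total mass $1$; it is regarded as the power series $Z_f(t)$ in $t=q^{-s}$. **Generating functions.** Let $\mathbb C[\Gamma_k]$ be the group algebra of $\Gamma_k=\{\gamma^A: A\in R/\pi^kR\}$, $\gamma^A\gamma^B=\gamma^{A+B}$, and let $\mathcal G=\varprojlim \mathbb C[\Gamma_k]$ with coordinate maps $\phi_k$. The generating function $G_f\in\mathcal G$ of $f$ is given by $\phi_k(G_f)=q^{-nk}\sum_{A\in(R/\pi^kR)^n}\gamma^{f(A)}$. Its head $H_f\in\mathcal G$ is the element for which $\phi_k(H_f)$, $k\ge1$, is the same sum restricted to those $A\not\equiv(0,\dots,0)\pmod\pi$. For a coset $A=a+\pi^jR$ or a singleton $A=\{a\}$, $z^A\in\mathcal G$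 is the element for which $\phi_k(z^A)$ is the average of the $\gamma^C$ over all $C\in R/\pi^kR$ with $C\cap A\neq\emptyset$; write $z^a=z^{\{a\}}$. For $s\in R$ and $F=F(z)\in\mathcal G$, $F(z^s)\in\mathcal G$ is obtained by replacing each $\gamma^A$ by $\gamma^{sA}$. Finally, $\operatorname{Ig}:\mathcal G\to\mathbb C[[t]]$ is $\operatorname{Ig}(F)=\sum_{k\ge0}(F_{\pi^kR}-F_{\pi^{k+1}R})t^k$, where $F_{\pi^kR}$ is the coefficient of $\gamma^{\pi^kR}$ in $\phi_k(F)$. **Quadratic polynomials.** A quadratic form over $R$ is given by a symmetric matrix over $R$; it is unimodular if the determinant of this matrix is a unit (the zero form, in no variables, is unimodular of rank $0$). The symbol $\bigoplus$ denotes a sum of polynomials in disjoint sets of variables. Let $$Q=\bigoplus_{i\in\mathbb N}\pi^iQ_i\oplus L+c,$$ where each $Q_i$ is a unimodular quadratic form of rank $r_i$ over $R$, $\omega$ is a positive integer with $Q_i=0$ for $i>\omega$, $L$ is a linear form over $R$ involving at most one indeterminate, and $c\in R$. For $j\in\mathbb N$ let $$Q_{(j)}=\bigoplus_{0\le i\le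 j,\ i\equiv j\,(2)}Q_i,\qquad r_{(j)}=\sum_{0\le i\le j,\ i\equiv j\,(2)}r_i,\qquad q_{(j)}=q^{\sum_{0\le i<j}r_{(i)}}.$$ For $a\in R$, $\mu\in\mathbb N$ and quadratic forms $P_0,\dots,P_{2\ell}$ let $$I_a(P_0,\dots,P_{2\ell})=\operatorname{Ig}\bigl(z^aH_{P_0}(z)G_{P_1}(z^{\pi})\cdots G_{P_{2\ell}}(z^{\pi^{2\ell}})\bigr),$$ $$I_a^\mu(P_0,\dots,P_{2\ell})=\operatorname{Ig}\bigl(z^{a+\pi^\mu R}H_{P_0}(z)G_{P_1}(z^{\pi})\cdots G_{P_{2\ell}}(z^{\pi^{2\ell}})\bigr).$$ Argument lists below are cut off after $2\ell+1$ entries (so only the first entry remains if $\ell=0$). Write $\mathbf Q_i=(Q_{(i)},Q_{(i+1)},Q_{i+2},Q_{i+3},\dots,Q_{i+2\ell})$. **Theorem.** As power series in $t=q^{-s}$, convergent to $Z_Q(s)$ for all $s$ with $\operatorname{Re}(s)>0$: 1. If $L=0$ and $c=0$, then with $r=\sum_i r_i$, $$Z_Q(t)=\sum_{0\le i<\omega-1}\frac{t^i}{q_{(i)}}I_0(\mathbf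 Q_i)+\Bigl(\frac{t^{\omega-1}}{q_{(\omega-1)}}I_0(Q_{(\omega-1)},Q_{(\omega)},0,\dots,0)+\frac{t^{\omega}}{q_{(\omega)}}I_0(Q_{(\omega)},Q_{(\omega-1)},0,\dots,0)\Bigr)\Bigl(1-\frac{t^2}{q^r}\Bigr)^{-1}.$$ 2. If $L=bx$ with $v(b)=\lambda<\infty$ and $v(b)\le v(c)$, then $$Z_Q(t)=\sum_{0\le i<\lambda-2\ell}\frac{t^i}{q_{(i)}}I_0(\mathbf Q_i)+\sum_{\max\{0,\lambda-2\ell\}\le i<\lambda}\frac{t^i}{q_{(i)}}I_0^{\lambda-i}(\mathbf Q_i)+\frac{t^\lambda}{q_{(\lambda)}}\cdot\frac{1-1/q}{1-t/q}.$$ 3. If $L=bx$ with $v(b)=\lambda<\infty$ and $v(c)<v(b)\le v(c)+2\ell$, then with $\kappa=v(c)$, $$Z_Q(t)=\sum_{0\le i<\lambda-2\ell}\frac{t^i}{q_{(i)}}I_{c/\pi^i}(\mathbf Q_i)+\sum_{\max\{0,\lambda-2\ell\}\le i\le\kappa}\frac{t^i}{q_{(i)}}I_{c/\pi^i}^{\lambda-i}(\mathbf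 Q_i)+\frac{t^\kappa}{q_{(\kappa+1)}}.$$ 4. If $L=bx$ with $v(b)>v(c)+2\ell$ (this includes $L=0$, $c\ne0$), then with $\kappa=v(c)$, $$Z_Q(t)=\sum_{0\le i\le\kappa}\frac{t^i}{q_{(i)}}I_{c/\pi^i}(\mathbf Q_i)+\frac{t^\kappa}{q_{(\kappa+1)}}.$$ -/

import Mathlib

open IsLocalRing MeasureTheory
open scoped ValuativeRel

noncomputable section

namespace QuadZeta

/-! ### The finite quotients of a discrete valuation ring

Throughout, `R` is a discrete valuation ring with finite residue field and maximal ideal `𝔪`.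
For any uniformizer `π` one has `𝔪 ^ k = π ^ k R`. -/

/-- The number `q` of elements of the residue field. -/
def resCard (R : Type*) [CommRing R] [IsLocalRing R] : ℕ := Nat.card (ResidueField R)

/-- The quotient ring `R / π ^ k R`. -/
abbrev Lvl (R : Type*) [CommRing R] [IsLocalRing R] (k : ℕ) : Type _ :=
  R ⧸ (maximalIdeal R ^ k)

/-- The class of `a` in `R / π ^ k R`. -/
abbrev cls {R : Type*} [CommRing R] [IsLocalRing R] (k : ℕ) (a : R) : Lvl R k :=
  Ideal.Quotient.mk (maximalIdeal R ^ k) a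

instance instFiniteLvl (R : Type*) [CommRing R] [IsDomain R] [IsDiscreteValuationRing R]
    [Finite (ResidueField R)] (k : ℕ) : Finite (Lvl R k) := by
  have : Finite (R ⧸ maximalIdeal R) := inferInstanceAs (Finite (ResidueField R))
  exact Ideal.finite_quotient_pow (IsNoetherian.noetherian _) k

instance instFintypeLvl (R : Type*) [CommRing R] [IsDomain R] [IsDiscreteValuationRing R]
    [Finite (ResidueField R)] (k : ℕ) : Fintype (Lvl R k) := Fintype.ofFinite _

/-- The projection `R / π ^ k R → R / π ^ j R` for `j ≤ k`. -/
def proj (R : Type*) [CommRing R] [IsLocalRing R] {j k : ℕ} (h : j ≤ k) : Lvl R k →+* Lvl R j :=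
  Ideal.Quotient.factor (Ideal.pow_le_pow_right h)

@[simp] theorem proj_cls {R : Type*} [CommRing R] [IsLocalRing R] {j k : ℕ} (h : j ≤ k) (a : R) :
    proj R h (cls k a) = cls j a := rfl

theorem cls_surjective {R : Type*} [CommRing R] [IsLocalRing R] (k : ℕ) :
    Function.Surjective (cls k : R → Lvl R k) := Ideal.Quotient.mk_surjective

/-! ### The algebra of `p`-adic generating functions -/

/-- The group algebra `ℂ[Γ_k]`, where `Γ_k = {γ ^ A : A ∈ R / π ^ k R}`;
`AddMonoidAlgebra.single A 1` is `γ ^ A`. -/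
abbrev GrpAlg (R : Type*) [CommRing R] [IsLocalRing R] (k : ℕ) : Type _ :=
  AddMonoidAlgebra ℂ (Lvl R k)

/-- `γ ^ A`. -/
abbrev gam {R : Type*} [CommRing R] [IsLocalRing R] {k : ℕ} (A : Lvl R k) : GrpAlg R k :=
  AddMonoidAlgebra.single A 1

/-- The projection `φ_{k,j} : ℂ[Γ_k] → ℂ[Γ_j]`. -/
def phi (R : Type*) [CommRing R] [IsLocalRing R] {j k : ℕ} (h : j ≤ k) :
    GrpAlg R k →ₐ[ℂ] GrpAlg R j :=
  AddMonoidAlgebra.mapDomainAlgHom ℂ ℂ (proj R h).toAddMonoidHom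

@[simp] theorem phi_gam {R : Type*} [CommRing R] [IsLocalRing R] {j k : ℕ} (h : j ≤ k)
    (A : Lvl R k) : phi R h (gam A) = gam (proj R h A) := by
  simp [phi, gam]

theorem phi_phi {R : Type*} [CommRing R] [IsLocalRing R] {i j k : ℕ} (h : i ≤ j) (h' : j ≤ k)
    (x : GrpAlg R k) : phi R h (phi R h' x) = phi R (h.trans h') x := by
  have : (phi R h).comp (phi R h') = phi R (h.trans h') := by
    unfold phi
    rw [← AddMonoidAlgebra.mapDomainAlgHom_comp]
    congr 1
    ext A
    obtain ⟨a, rfl⟩ := cls_surjective k A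
    rfl
  exact DFunLike.congr_fun this x

/-- The inverse limit `𝒢` of the group algebras `ℂ[Γ_k]`; the coordinate map `φ_k` is
`fun F ↦ F.1 k`. -/
def GenAlg (R : Type*) [CommRing R] [IsLocalRing R] : Subalgebra ℂ (∀ k, GrpAlg R k) where
  carrier := {F | ∀ (j k : ℕ) (h : j ≤ k), phi R h (F k) = F j}
  mul_mem' hF hG j k h := by simp [hF j k h, hG j k h]
  add_mem' hF hG j k h := by simp [hF j k h, hG j k h]
  algebraMap_mem' c j k h := (phi R h).commutes c

/-- If all fibres of `f : T → U` have the same number of elements, then averages over `T` and `U`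
correspond. -/
theorem avg_fiber {X Y M : Type*} [AddCommGroup M] [Module ℂ M] [DecidableEq Y]
    (T : Finset X) (U : Finset Y) (f : X → Y) (g : Y → M) (c : ℕ) (hc : c ≠ 0)
    (hTU : ∀ x ∈ T, f x ∈ U) (hfib : ∀ y ∈ U, (T.filter (fun x ↦ f x = y)).card = c) :
    T.card = c * U.card ∧
      ((T.card : ℂ))⁻¹ • ∑ x ∈ T, g (f x) = ((U.card : ℂ))⁻¹ • ∑ y ∈ U, g y := by
  have h1 : T.card = c * U.card := by
    rw [Finset.card_eq_sum_card_fiberwise (f := f) (t := U) hTU, Finset.sum_congr rfl hfib]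
    simp [mul_comm]
  refine ⟨h1, ?_⟩
  have h2 : ∑ x ∈ T, g (f x) = (c : ℂ) • ∑ y ∈ U, g y := by
    rw [← Finset.sum_fiberwise_of_maps_to hTU, Finset.smul_sum]
    refine Finset.sum_congr rfl fun y hy ↦ ?_
    rw [Finset.sum_congr rfl (g := fun _ ↦ g y)
      (fun x hx ↦ by rw [(Finset.mem_filter.1 hx).2]), Finset.sum_const, hfib y hy, Nat.cast_smul_eq_nsmul]
  have hc' : (c : ℂ) ≠ 0 := by exact_mod_cast hc
  rw [h2, h1, smul_smul, Nat.cast_mul, mul_inv, mul_comm (c : ℂ)⁻¹, mul_assoc,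
    inv_mul_cancel₀ hc', mul_one]

theorem card_lvl (R : Type*) [CommRing R] [IsDomain R] [IsDiscreteValuationRing R]
    [Finite (ResidueField R)] (k : ℕ) : Nat.card (Lvl R k) = resCard R ^ k := by
  have := cardQuot_pow_of_prime (P := maximalIdeal R)
    (IsDiscreteValuationRing.not_a_field R) (i := k)
  exact this

/-- `z ^ A` for the coset `A = a + I` of an ideal `I` of `R`, that is, a coset of some `π ^ j R`
(for `I = 𝔪 ^ j`) or a singleton (for `I = ⊥`):
`φ_k(z ^ A)` is the average of `γ ^ C` over all `C ∈ R / π ^ k R` that meet `A`. -/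
def zCoset {R : Type*} [CommRing R] [IsDomain R] [IsDiscreteValuationRing R]
    [Finite (ResidueField R)] (a : R) (I : Ideal R) : GenAlg R :=
  open Classical in
  ⟨fun k ↦
    (((Finset.univ.filter (fun C : Lvl R k ↦ ∃ x ∈ I, cls k (a + x) = C)).card : ℂ))⁻¹ •
      ∑ C ∈ Finset.univ.filter (fun C : Lvl R k ↦ ∃ x ∈ I, cls k (a + x) = C), gam C, by
    classical
    intro j k h
    simp only [map_smul, map_sum, phi_gam]
    obtain ⟨c, hc⟩ : ∃ c, c = (((Finset.univ.filter
      (fun C : Lvl R k ↦ ∃ x ∈ I, cls k (a + x) = C)).filter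
        (fun C ↦ proj R h C = cls j a)).card) := ⟨_, rfl⟩
    refine (avg_fiber (M := GrpAlg R j) _ _ (proj R h) gam c ?_ ?_ ?_).2
    · rw [hc]
      refine (Finset.card_pos.2 ⟨cls k a, ?_⟩).ne'
      simp only [Finset.mem_filter, Finset.mem_univ, true_and]
      exact ⟨⟨0, I.zero_mem, by simp⟩, rfl⟩
    · intro C hC
      simp only [Finset.mem_filter, Finset.mem_univ, true_and] at hC ⊢
      obtain ⟨x, hx, rfl⟩ := hC
      exact ⟨x, hx, (proj_cls h (a + x)).symm⟩
    · intro D hD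
      simp only [Finset.mem_filter, Finset.mem_univ, true_and] at hD
      obtain ⟨x, hx, rfl⟩ := hD
      rw [hc]
      refine Finset.card_bij' (fun C _ ↦ C - cls k x) (fun C _ ↦ C + cls k x) ?_ ?_ ?_ ?_
      · intro C hC
        simp only [Finset.mem_filter, Finset.mem_univ, true_and] at hC ⊢
        obtain ⟨⟨y, hy, rfl⟩, h2⟩ := hC
        refine ⟨⟨y - x, I.sub_mem hy hx, by simp [add_sub_assoc]⟩, ?_⟩
        rw [map_sub, h2]; simp
      · intro C hC
        simp only [Finset.mem_filter, Finset.mem_univ, true_and] at hC ⊢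
        obtain ⟨⟨y, hy, rfl⟩, h2⟩ := hC
        refine ⟨⟨y + x, I.add_mem hy hx, by simp [add_assoc]⟩, ?_⟩
        rw [map_add, h2]; simp
      · intro C _; simp
      · intro C _; simp⟩

/-- `F(z ^ s)`: replace every `γ ^ A` by `γ ^ (s A)`. On elements of the inverse limit this is the
same as replacing, for `k ≥ v(s)`, the exponents `A ∈ R / π ^ (k - v(s)) R` of `φ_{k-v(s)}(F)` by
`s A ∈ R / π ^ k R`. -/
def scale {R : Type*} [CommRing R] [IsLocalRing R] (s : R) (F : GenAlg R) : GenAlg R :=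
  ⟨fun k ↦ AddMonoidAlgebra.mapDomainAlgHom ℂ ℂ (AddMonoidHom.mulLeft (cls k s)) (F.1 k), by
    intro j k h
    have hF : phi R h (F.1 k) = F.1 j := F.2 j k h
    beta_reduce
    rw [← hF]
    have : (phi R h).comp (AddMonoidAlgebra.mapDomainAlgHom ℂ ℂ (AddMonoidHom.mulLeft (cls k s)))
        = (AddMonoidAlgebra.mapDomainAlgHom ℂ ℂ (AddMonoidHom.mulLeft (cls j s))).comp
          (phi R h) := by
      unfold phi
      rw [← AddMonoidAlgebra.mapDomainAlgHom_comp, ← AddMonoidAlgebra.mapDomainAlgHom_comp]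
      congr 1
      ext A
      obtain ⟨a, rfl⟩ := cls_surjective k A
      rfl
    exact DFunLike.congr_fun this (F.1 k)⟩

/-- `scale` is as described: if `g : R / π ^ j R → R / π ^ k R` is induced by multiplication by `s`
(which exists for `j = k - v(s)` if `k ≥ v(s)`, and for `j = 0` if `k ≤ v(s)`), then `φ_k(F(z ^ s))`
is the image of `φ_j(F)` under `γ ^ A ↦ γ ^ (g A)`. -/
theorem scale_apply {R : Type*} [CommRing R] [IsLocalRing R] (s : R) (F : GenAlg R) {j k : ℕ}
    (h : j ≤ k) (g : Lvl R j →+ Lvl R k) (hg : ∀ a, g (cls j a) = cls k (s * a)) :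
    (scale s F).1 k = AddMonoidAlgebra.mapDomainAlgHom ℂ ℂ g (F.1 j) := by
  have hF : phi R h (F.1 k) = F.1 j := F.2 j k h
  rw [← hF]
  have : AddMonoidAlgebra.mapDomainAlgHom ℂ ℂ (AddMonoidHom.mulLeft (cls k s))
      = (AddMonoidAlgebra.mapDomainAlgHom ℂ ℂ g).comp (phi R h) := by
    unfold phi
    rw [← AddMonoidAlgebra.mapDomainAlgHom_comp]
    congr 1
    ext A
    obtain ⟨a, rfl⟩ := cls_surjective k A
    exact ((map_mul _ s a).symm.trans (hg a).symm)
  exact DFunLike.congr_fun this (F.1 k)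

/-! ### Generating functions of polynomials -/

/-- The modulo `π ^ k` generating function of `f ∈ R[x_h : h ∈ σ]`. -/
def modGen {R : Type*} [CommRing R] [IsDomain R] [IsDiscreteValuationRing R]
    [Finite (ResidueField R)] {σ : Type*} [Fintype σ] (f : MvPolynomial σ R) (k : ℕ) :
    GrpAlg R k :=
  open Classical in
  ((resCard R : ℂ) ^ (Fintype.card σ * k))⁻¹ • ∑ A : σ → Lvl R k, gam (MvPolynomial.aeval A f)

/-- `S ⊆ R ^ n` is `π ^ i`-regular: a union of products of cosets of `π ^ i R`. -/
def IsRegular {R : Type*} [CommRing R] [IsLocalRing R] {σ : Type*}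
    (S : Set (σ → R)) (i : ℕ) : Prop :=
  ∃ T : Set (σ → Lvl R i), S = {x | (fun h ↦ cls i (x h)) ∈ T}

/-- The partial modulo `π ^ k` generating function of `f` on `S`. -/
def partMod {R : Type*} [CommRing R] [IsDomain R] [IsDiscreteValuationRing R]
    [Finite (ResidueField R)] {σ : Type*} [Fintype σ] (f : MvPolynomial σ R) (S : Set (σ → R))
    (k : ℕ) : GrpAlg R k :=
  open Classical in
  ((resCard R : ℂ) ^ (Fintype.card σ * k))⁻¹ •
    ∑ A ∈ Finset.univ.filter (fun A : σ → Lvl R k ↦ {x | ∀ h, cls k (x h) = A h} ⊆ S),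
      gam (MvPolynomial.aeval A f)

theorem partMod_univ {R : Type*} [CommRing R] [IsDomain R] [IsDiscreteValuationRing R]
    [Finite (ResidueField R)] {σ : Type*} [Fintype σ] (f : MvPolynomial σ R) (k : ℕ) :
    partMod f Set.univ k = modGen f k := by
  simp [partMod, modGen]

theorem proj_aeval {R : Type*} [CommRing R] [IsLocalRing R] {σ : Type*} (f : MvPolynomial σ R)
    {j k : ℕ} (h : j ≤ k) (A : σ → Lvl R k) :
    proj R h (MvPolynomial.aeval A f) = MvPolynomial.aeval (fun i ↦ proj R h (A i)) f := by
  rw [MvPolynomial.aeval_def, MvPolynomial.aeval_def, MvPolynomial.hom_eval₂]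
  rfl

theorem phi_partMod {R : Type*} [CommRing R] [IsDomain R] [IsDiscreteValuationRing R]
    [Finite (ResidueField R)] {σ : Type*} [Fintype σ] (f : MvPolynomial σ R) (S : Set (σ → R))
    {i j k : ℕ} (hS : IsRegular S i) (hij : i ≤ j) (hjk : j ≤ k) :
    phi R hjk (partMod f S k) = partMod f S j := by
  classical
  obtain ⟨T, rfl⟩ := hS
  have key : ∀ m, i ≤ m → ∀ a : σ → R,
      ({x : σ → R | ∀ h, cls m (x h) = cls m (a h)} ⊆ {x | (fun h ↦ cls i (x h)) ∈ T}) ↔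
        (fun h ↦ cls i (a h)) ∈ T := by
    intro m hm a
    constructor
    · intro H; exact H (fun _ ↦ rfl)
    · intro H x hx
      have : (fun h ↦ cls i (x h)) = fun h ↦ cls i (a h) := by
        funext h
        rw [← proj_cls hm, hx h, proj_cls]
      simpa only [Set.mem_ofPred_eq, this] using H
  have lift : ∀ m (A : σ → Lvl R m), ∃ a : σ → R, A = fun h ↦ cls m (a h) := fun m A ↦
    ⟨fun h ↦ (cls_surjective m (A h)).choose,
      funext fun h ↦ (cls_surjective m (A h)).choose_spec.symm⟩
  have cardm : ∀ m, Nat.card (σ → Lvl R m) = resCard R ^ (Fintype.card σ * m) := by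
    intro m
    rw [Nat.card_fun, card_lvl, Nat.card_eq_fintype_card, ← pow_mul, mul_comm]
  let F : (σ → Lvl R k) →+ (σ → Lvl R j) :=
    { toFun := fun A h ↦ proj R hjk (A h)
      map_zero' := by funext h; simp
      map_add' := by intros; funext h; simp }
  have hF : Function.Surjective F := by
    intro B
    obtain ⟨b, rfl⟩ := lift j B
    exact ⟨fun h ↦ cls k (b h), rfl⟩
  let c := (Finset.univ.filter (fun A ↦ F A = 0)).card
  have hc : c ≠ 0 := (Finset.card_pos.2 ⟨0, by simp⟩).ne'
  have hfib : ∀ B, (Finset.univ.filter (fun A ↦ F A = B)).card = c := fun B ↦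
    AddMonoidHom.card_fiber_eq_of_mem_range F (hF B) (hF 0)
  have hcard := (avg_fiber (M := ℂ) Finset.univ Finset.univ F (fun _ ↦ 0) c hc (by simp)
    (fun B _ ↦ hfib B)).1
  rw [Finset.card_univ, Finset.card_univ, ← Nat.card_eq_fintype_card, ← Nat.card_eq_fintype_card,
    cardm, cardm] at hcard
  have hq : (resCard R : ℂ) ^ (Fintype.card σ * k) =
      c * (resCard R : ℂ) ^ (Fintype.card σ * j) := by exact_mod_cast hcard
  have hc' : (c : ℂ) ≠ 0 := by exact_mod_cast hc
  unfold partMod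
  simp only [map_smul, map_sum, phi_gam, proj_aeval]
  rw [hq, mul_inv, mul_comm, mul_smul]
  congr 1
  rw [inv_smul_eq_iff₀ hc', Finset.smul_sum]
  have maps : ∀ A ∈ Finset.univ.filter (fun A : σ → Lvl R k ↦
      {x : σ → R | ∀ h, cls k (x h) = A h} ⊆ {x : σ → R | (fun h ↦ cls i (x h)) ∈ T}),
      F A ∈ Finset.univ.filter (fun A : σ → Lvl R j ↦
      {x : σ → R | ∀ h, cls j (x h) = A h} ⊆ {x : σ → R | (fun h ↦ cls i (x h)) ∈ T}) := by
    intro A hA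
    obtain ⟨a, rfl⟩ := lift k A
    rw [Finset.mem_filter, key k (hij.trans hjk)] at hA
    have : F (fun h ↦ cls k (a h)) = fun h ↦ cls j (a h) := rfl
    rw [this, Finset.mem_filter, key j hij]
    exact ⟨Finset.mem_univ _, hA.2⟩
  rw [← Finset.sum_fiberwise_of_maps_to maps]
  refine Finset.sum_congr rfl fun B hB ↦ ?_
  have e : (Finset.univ.filter (fun A : σ → Lvl R k ↦
      {x : σ → R | ∀ h, cls k (x h) = A h} ⊆ {x : σ → R | (fun h ↦ cls i (x h)) ∈ T})).filter
      (fun A ↦ F A = B) = Finset.univ.filter (fun A ↦ F A = B) := by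
    ext A
    simp only [Finset.mem_filter, Finset.mem_univ, true_and, and_iff_right_iff_imp]
    rintro rfl
    obtain ⟨a, rfl⟩ := lift k A
    rw [key k (hij.trans hjk)]
    have : F (fun h ↦ cls k (a h)) = fun h ↦ cls j (a h) := rfl
    rw [this, Finset.mem_filter, key j hij] at hB
    exact hB.2
  rw [e, Finset.sum_congr rfl (g := fun _ ↦ gam (MvPolynomial.aeval B f))
      (fun A hA ↦ by rw [← (Finset.mem_filter.1 hA).2]; rfl), Finset.sum_const, hfib B,
      Nat.cast_smul_eq_nsmul]

theorem isRegular_univ {R : Type*} [CommRing R] [IsLocalRing R] {σ : Type*} (i : ℕ) :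
    IsRegular (Set.univ : Set (σ → R)) i := ⟨Set.univ, by simp⟩

/-- The `p`-adic generating function `G_f` of `f`. -/
def genFun {R : Type*} [CommRing R] [IsDomain R] [IsDiscreteValuationRing R]
    [Finite (ResidueField R)] {σ : Type*} [Fintype σ] (f : MvPolynomial σ R) : GenAlg R :=
  ⟨fun k ↦ modGen f k, by
    intro j k h
    simp only [← partMod_univ]
    exact phi_partMod f _ (isRegular_univ 0) (Nat.zero_le _) h⟩

/-- The partial `p`-adic generating function of `f` on a `π ^ i`-regular set `S`: the element of
`𝒢` whose image in `ℂ[Γ_k]` is the partial modulo `π ^ k` generating function for all `k ≥ i`. -/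
def partGen {R : Type*} [CommRing R] [IsDomain R] [IsDiscreteValuationRing R]
    [Finite (ResidueField R)] {σ : Type*} [Fintype σ] (f : MvPolynomial σ R) (S : Set (σ → R))
    (i : ℕ) (hS : IsRegular S i) : GenAlg R :=
  ⟨fun k ↦ phi R (le_max_left k i) (partMod f S (max k i)), by
    intro j k h
    have h1 : max j i ≤ max k i := max_le_max_right i h
    simp only [phi_phi]
    rw [← phi_partMod f S hS (le_max_right j i) h1, phi_phi]⟩

/-- `partGen` is as described. -/
theorem partGen_apply {R : Type*} [CommRing R] [IsDomain R] [IsDiscreteValuationRing R]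
    [Finite (ResidueField R)] {σ : Type*} [Fintype σ] (f : MvPolynomial σ R) (S : Set (σ → R))
    (i : ℕ) (hS : IsRegular S i) (k : ℕ) (hk : i ≤ k) :
    (partGen f S i hS).1 k = partMod f S k :=
  phi_partMod f S hS hk (le_max_left k i)

/-- The region `R ^ n ∖ (π R) ^ n`. -/
def headRegion (R : Type*) [CommRing R] [IsLocalRing R] (σ : Type*) : Set (σ → R) :=
  {x | ¬ ∀ h, x h ∈ maximalIdeal R}

theorem isRegular_headRegion (R : Type*) [CommRing R] [IsLocalRing R] (σ : Type*) :
    IsRegular (headRegion R σ) 1 := by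
  refine ⟨{A | ¬ ∀ h, A h = 0}, ?_⟩
  ext x
  simp [headRegion, Ideal.Quotient.eq_zero_iff_mem]

/-- The head `H_f` of the `p`-adic generating function of `f`. -/
def head {R : Type*} [CommRing R] [IsDomain R] [IsDiscreteValuationRing R]
    [Finite (ResidueField R)] {σ : Type*} [Fintype σ] (f : MvPolynomial σ R) : GenAlg R :=
  partGen f (headRegion R σ) 1 (isRegular_headRegion R σ)

/-- The map `Ig : 𝒢 → ℂ⟦t⟧`, `Ig(F) = ∑_k (F_{π^k R} - F_{π^(k+1) R}) t^k`, where `F_A` is the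
coefficient of `γ ^ A` in `φ_k(F)` for `A ∈ R / π ^ k R`. -/
def Ig {R : Type*} [CommRing R] [IsLocalRing R] (F : GenAlg R) : PowerSeries ℂ :=
  PowerSeries.mk fun k ↦ (F.1 k).coeff 0 - (F.1 (k + 1)).coeff 0

/-! ### Quadratic forms over `R` -/

/-- A quadratic form over `R`, given by a symmetric matrix over `R`; the variables are indexed by
the finite type `ι`. -/
structure QForm (R : Type*) [CommRing R] where
  /-- the index type of the variables -/
  ι : Type
  [fin : Fintype ι]
  [dec : DecidableEq ι]
  /-- the associated matrix -/
  mat : Matrix ι ι R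
  symm : mat.IsSymm

attribute [instance] QForm.fin QForm.dec

namespace QForm

/-- The polynomial `∑ M_{ij} x_i x_j` of the form with matrix `M`. -/
def poly {R : Type*} [CommRing R] (P : QForm R) : MvPolynomial P.ι R :=
  ∑ i, ∑ j, MvPolynomial.C (P.mat i j) * MvPolynomial.X i * MvPolynomial.X j

/-- The determinant of the matrix of the form is a unit. The form in no variables is unimodular. -/
def Unimodular {R : Type*} [CommRing R] (P : QForm R) : Prop := IsUnit P.mat.det

/-- The number of variables. For a unimodular form this is the rank of its matrix. -/
def rank {R : Type*} [CommRing R] (P : QForm R) : ℕ := Fintype.card P.ι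

/-- The zero form, in no variables. -/
def zero (R : Type*) [CommRing R] : QForm R where
  ι := Empty
  mat := 0
  symm := Matrix.isSymm_zero

/-- The form `a P`. -/
def smul {R : Type*} [CommRing R] (a : R) (P : QForm R) : QForm R where
  ι := P.ι
  mat := a • P.mat
  symm := P.symm.smul a

/-- The direct sum `⨁_{i ∈ s} Q_i`: the sum of the forms, in disjoint sets of variables. -/
def directSum {R : Type*} [CommRing R] (s : Finset ℕ) (Q : ℕ → QForm R) : QForm R where
  ι := Σ i : s, (Q i).ι
  mat := Matrix.blockDiagonal' fun i : s ↦ (Q i).mat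
  symm := by
    rw [Matrix.IsSymm, Matrix.blockDiagonal'_transpose]
    congr 1
    funext i
    exact (Q i).symm

end QForm

/-- The indices `i` with `0 ≤ i ≤ j` and `i ≡ j (mod 2)`. -/
def parityIdx (j : ℕ) : Finset ℕ := (Finset.range (j + 1)).filter fun i ↦ i ≡ j [MOD 2]

/-- `Q_(j) = ⨁ Q_i`, over `0 ≤ i ≤ j` with `i ≡ j (mod 2)`. -/
def parSum {R : Type*} [CommRing R] (Q : ℕ → QForm R) (j : ℕ) : QForm R :=
  QForm.directSum (parityIdx j) Q

/-- `r_(j) = ∑ r_i`, over `0 ≤ i ≤ j` with `i ≡ j (mod 2)`. -/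
def parRank {R : Type*} [CommRing R] (Q : ℕ → QForm R) (j : ℕ) : ℕ :=
  ∑ i ∈ parityIdx j, (Q i).rank

/-- `q_(j) = q ^ (∑_{0 ≤ i < j} r_(i))`. -/
def parQ {R : Type*} [CommRing R] [IsLocalRing R] (Q : ℕ → QForm R) (j : ℕ) : ℕ :=
  resCard R ^ ∑ i ∈ Finset.range j, parRank Q i

/-- The quadratic polynomial `⨁_{0 ≤ i ≤ ω} π ^ i Q_i ⊕ L + c` with `L = ∑_j b_j y_j`. -/
def quadPoly {R : Type*} [CommRing R] (π : R) (ω : ℕ) (Q : ℕ → QForm R) {m : ℕ} (b : Fin m → R)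
    (c : R) :
    MvPolynomial ((QForm.directSum (Finset.range (ω + 1))
      (fun i ↦ (Q i).smul (π ^ i))).ι ⊕ Fin m) R :=
  MvPolynomial.rename Sum.inl
      (QForm.directSum (Finset.range (ω + 1)) (fun i ↦ (Q i).smul (π ^ i))).poly
    + ∑ j, MvPolynomial.C (b j) * MvPolynomial.X (Sum.inr j) + MvPolynomial.C c

/-- The term `t ^ i / q_(j)` of `ℂ⟦t⟧`. -/
def wt {R : Type*} [CommRing R] [IsLocalRing R] (Q : ℕ → QForm R) (i j : ℕ) : PowerSeries ℂ :=
  (parQ Q j : ℂ)⁻¹ • PowerSeries.X ^ i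

/-- The power series `(1 - 1/q) / (1 - t/q)`, the local zeta function of the polynomial `x`. -/
def linZeta (R : Type*) [CommRing R] [IsLocalRing R] : PowerSeries ℂ :=
  (1 - (resCard R : ℂ)⁻¹) • (1 - (resCard R : ℂ)⁻¹ • PowerSeries.X)⁻¹

/-- The power series `(1 - t ^ 2 / q ^ r)⁻¹`. -/
def poleFactor (R : Type*) [CommRing R] [IsLocalRing R] (r : ℕ) : PowerSeries ℂ :=
  (1 - ((resCard R : ℂ) ^ r)⁻¹ • PowerSeries.X ^ 2)⁻¹

/-! ### The terms `I_a` and `I_a^μ` -/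

/-- `H_{P_0}(z) G_{P_1}(z ^ π) ⋯ G_{P_{2ℓ}}(z ^ (π ^ (2ℓ)))`. -/
def coreProd {R : Type*} [CommRing R] [IsDomain R] [IsDiscreteValuationRing R]
    [Finite (ResidueField R)] (π : R) (l : ℕ) (P : Fin (2 * l + 1) → QForm R) : GenAlg R :=
  head (P 0).poly * ∏ j : Fin (2 * l), scale (π ^ (j.val + 1)) (genFun (P j.succ).poly)

/-- `I_a(P_0, …, P_{2ℓ}) = Ig(z ^ a H_{P_0}(z) G_{P_1}(z ^ π) ⋯ G_{P_{2ℓ}}(z ^ (π ^ (2ℓ))))`. -/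
def igI {R : Type*} [CommRing R] [IsDomain R] [IsDiscreteValuationRing R]
    [Finite (ResidueField R)] (π : R) (l : ℕ) (a : R) (P : Fin (2 * l + 1) → QForm R) :
    PowerSeries ℂ :=
  Ig (zCoset a ⊥ * coreProd π l P)

/-- `I_a^μ(P_0, …, P_{2ℓ})`, with `z ^ (a + π ^ μ R)` in place of `z ^ a`. -/
def igIμ {R : Type*} [CommRing R] [IsDomain R] [IsDiscreteValuationRing R]
    [Finite (ResidueField R)] (π : R) (l : ℕ) (μ : ℕ) (a : R) (P : Fin (2 * l + 1) → QForm R) :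
    PowerSeries ℂ :=
  Ig (zCoset a (maximalIdeal R ^ μ) * coreProd π l P)

/-- The tuple `(Q_(i), Q_(i+1), Q_{i+2}, …, Q_{i+2ℓ})`; just `(Q_(i))` if `ℓ = 0`. -/
def tup {R : Type*} [CommRing R] (l : ℕ) (Q : ℕ → QForm R) (i : ℕ) : Fin (2 * l + 1) → QForm R :=
  fun j ↦ if j.val ≤ 1 then parSum Q (i + j.val) else Q (i + j.val)

/-- The tuple `(A, B, 0, …, 0)`; just `(A)` if `ℓ = 0`. -/
def tupPair {R : Type*} [CommRing R] (l : ℕ) (A B : QForm R) : Fin (2 * l + 1) → QForm R :=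
  fun j ↦ if j.val = 0 then A else if j.val = 1 then B else QForm.zero R

/-- `c / π ^ i` for `π ^ i ∣ c`. -/
def divPow {R : Type*} [CommRing R] (π c : R) (i : ℕ) : R :=
  open Classical in if h : π ^ i ∣ c then h.choose else 0

theorem pow_mul_divPow {R : Type*} [CommRing R] {π c : R} {i : ℕ} (h : π ^ i ∣ c) :
    π ^ i * divPow π c i = c := by
  rw [divPow, dif_pos h]; exact h.choose_spec.symm

/-! ### The Igusa local zeta function -/

/-- The absolute value `|a| = q ^ (-v(a))`, with `|0| = 0`. -/
def absVal {R : Type*} [CommRing R] [IsDomain R] [IsDiscreteValuationRing R] (a : R) : ℝ :=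
  open Classical in
  if a = 0 then 0 else ((resCard R : ℝ) ^ (IsDiscreteValuationRing.addVal R a).toNat)⁻¹

/-- The Haar measure on `R ^ n` of total mass `1`. -/
def haarPow (R : Type*) [CommRing R] [TopologicalSpace R] [IsTopologicalRing R] [CompactSpace R]
    [MeasurableSpace R] [BorelSpace R] (σ : Type*) [Fintype σ] : Measure (σ → R) :=
  Measure.pi fun _ ↦ Measure.addHaarMeasure (⊤ : TopologicalSpace.PositiveCompacts R)

/-- The integrand `|f(x)| ^ s`. -/
def zetaIntegrand {R : Type*} [CommRing R] [IsDomain R] [IsDiscreteValuationRing R] {σ : Type*}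
    (f : MvPolynomial σ R) (s : ℂ) (x : σ → R) : ℂ :=
  ((absVal (MvPolynomial.eval x f) : ℝ) : ℂ) ^ s

/-- The Igusa local zeta function `Z_f(s) = ∫_{R ^ n} |f(x)| ^ s dx`. -/
def igusaZeta {R : Type*} [CommRing R] [IsDomain R] [IsDiscreteValuationRing R]
    [TopologicalSpace R] [IsTopologicalRing R] [CompactSpace R] [MeasurableSpace R] [BorelSpace R]
    {σ : Type*} [Fintype σ] (f : MvPolynomial σ R) (s : ℂ) : ℂ :=
  ∫ x, zetaIntegrand f s x ∂(haarPow R σ)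

/-- `Z_f(t) = Z` as functions of `t`: for all `s` with `Re s > 0` the integral that defines `Z_f(s)`
converges absolutely, and the power series `Z` converges at `t = q ^ (-s)` to `Z_f(s)`.
There is at most one such power series `Z`. -/
def ZetaEq {R : Type*} [CommRing R] [IsDomain R] [IsDiscreteValuationRing R]
    [TopologicalSpace R] [IsTopologicalRing R] [CompactSpace R] [MeasurableSpace R] [BorelSpace R]
    {σ : Type*} [Fintype σ] (f : MvPolynomial σ R) (Z : PowerSeries ℂ) : Prop :=
  ∀ s : ℂ, 0 < s.re → Integrable (zetaIntegrand f s) (haarPow R σ) ∧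
    HasSum (fun k : ℕ ↦ PowerSeries.coeff k Z * ((resCard R : ℂ) ^ (-s)) ^ k) (igusaZeta f s)

end QuadZeta

end

/-! The coefficient of `γ^0` in `φ_k(G_f)` is the proportion of zeros of `f` modulo `π^k`, that is,
the measure of `{x : π^k ∣ f(x)}`. So the `k`-th coefficient of `Ig(G_f)` is the measure of `{x :
v(f(x)) = k}`, where the integrand is `t^k`, and termwise integration gives `Z_f = Ig(G_f)`
(`zetaEq_genFun`). The rest is algebra in `𝒢`. Disjoint variables turn sums into products, so `G_Q`
is `z^(c + bR)` times the product of the `G_{Q_i}(z^(π^i))` (`genFun_quadPoly`).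

Two facts about a unimodular form `P` of rank `r` carry the argument. Splitting vectors into
primitive ones and multiples of `π` gives `G_P(z) = H_P(z) + q^(-r) G_P(z^(π^2))`
(`genFun_eq_head_add`). At a primitive vector the gradient of `P` has valuation exactly `ℓ`, so by a
Hensel-type perturbation the values on primitive vectors are equidistributed in cosets of `π^(2ℓ+1)
R` (`head_mul_gam`, `head_mul_scale_zUnif`). Hence `H_P` absorbs every factor `F(z^s)` with `v(s) >
2ℓ`, leaving only the mass of `F`.

Apply the splitting to the first factor of `G_{Q_(i)}(z) G_{Q_(i+1)}(z^π) G_{Q_{i+2}}(z^(π^2)) ⋯`.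
In the head term all factors beyond index `2ℓ` disappear. In the other term `G_{Q_(i)}(z^(π^2))`
merges with `G_{Q_{i+2}}(z^(π^2))` into `G_{Q_(i+2)}(z^(π^2))`, and the result is the same kind of
product for `i + 1`, evaluated at `z^π` (`stage_eq`). Since `Ig(F(z^π)) = t Ig(F)`, each step costs
a factor `t / q^(r_(i))`, as long as `z^(c + bR)` is also a function of `z^π`.

The cases differ in how the recursion ends. For `L = 0`, `c = 0` the products have period 2 from `ω
- 1` on, and a linear system with determinant `1 - t^2 / q^r` remains. For `v(b) ≤ v(c)` the factor
`z^R` appears after `v(b)` steps and absorbs everything. For `v(c) < v(b)` the constant becomes a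
unit after `v(c)` steps, and the non-head term then takes only unit values. The threshold `2ℓ` marks
where a head no longer distinguishes `z^(a + π^μ R)` from `z^a`. -/

namespace QuadZeta

/-! ### The algebra `𝒢`: scaling, total mass and the map `Ig` -/

noncomputable section Algebra

variable {R : Type*} [CommRing R]

section Local

variable [IsLocalRing R]

/-- Higher coordinates determine lower ones. This allows low levels to be ignored, where heads have
no direct formula or the perturbation argument fails. -/
theorem GenAlg.ext_of_le (N : ℕ) {F G : GenAlg R} (h : ∀ k, N ≤ k → F.1 k = G.1 k) : F = G := by
  refine Subtype.ext (funext fun k ↦ ?_)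
  rw [← F.2 k (max k N) (le_max_left _ _), ← G.2 k (max k N) (le_max_left _ _),
    h _ (le_max_right _ _)]

theorem cls_add (k : ℕ) (a b : R) : cls k (a + b) = cls k a + cls k b := rfl

theorem cls_mul (k : ℕ) (a b : R) : cls k (a * b) = cls k a * cls k b := rfl

theorem cls_sub (k : ℕ) (a b : R) : cls k (a - b) = cls k a - cls k b := rfl

theorem cls_zero (k : ℕ) : cls k (0 : R) = 0 := rfl

theorem gam_mul_gam {k : ℕ} (A B : Lvl R k) : (gam A * gam B : GrpAlg R k) = gam (A + B) := by
  simp [gam, AddMonoidAlgebra.single_mul_single]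

theorem gam_zero {k : ℕ} : (gam 0 : GrpAlg R k) = 1 := rfl

theorem mapDomain_gam {j k : ℕ} (f : Lvl R j →+ Lvl R k) (A : Lvl R j) :
    AddMonoidAlgebra.mapDomainAlgHom ℂ ℂ f (gam A) = gam (f A) := by
  simp [gam]

theorem prod_gam {k : ℕ} {ι : Type*} (s : Finset ι) (A : ι → Lvl R k) :
    ∏ i ∈ s, (gam (A i) : GrpAlg R k) = gam (∑ i ∈ s, A i) := by
  classical
  induction s using Finset.induction_on with
  | empty => simp [gam_zero]
  | insert i s hi ih => rw [Finset.prod_insert hi, Finset.sum_insert hi, ih, gam_mul_gam]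

theorem GenAlg.mul_apply (F G : GenAlg R) (k : ℕ) : (F * G).1 k = F.1 k * G.1 k := rfl

theorem GenAlg.add_apply (F G : GenAlg R) (k : ℕ) : (F + G).1 k = F.1 k + G.1 k := rfl

theorem GenAlg.smul_apply (c : ℂ) (F : GenAlg R) (k : ℕ) : (c • F).1 k = c • F.1 k := rfl

theorem GenAlg.one_apply (k : ℕ) : (1 : GenAlg R).1 k = 1 := rfl

/-- The coordinate map `φ_k`. -/
def level (k : ℕ) : GenAlg R →ₐ[ℂ] GrpAlg R k :=
  (Pi.evalAlgHom ℂ (GrpAlg R) k).comp (GenAlg R).val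

theorem level_apply (k : ℕ) (F : GenAlg R) : level k F = F.1 k := rfl

/-- `F ↦ F(z ^ s)` as a homomorphism of algebras. -/
def scaleHom (s : R) : GenAlg R →ₐ[ℂ] GenAlg R where
  toFun := scale s
  map_one' := Subtype.ext (funext fun _ ↦ map_one _)
  map_mul' _ _ := Subtype.ext (funext fun _ ↦ map_mul _ _ _)
  map_zero' := Subtype.ext (funext fun _ ↦ map_zero _)
  map_add' _ _ := Subtype.ext (funext fun _ ↦ map_add _ _ _)
  commutes' c := Subtype.ext (funext fun k ↦
    (AddMonoidAlgebra.mapDomainAlgHom ℂ ℂ (AddMonoidHom.mulLeft (cls k s))).commutes c)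

theorem scale_mul (s : R) (F G : GenAlg R) : scale s (F * G) = scale s F * scale s G :=
  map_mul (scaleHom s) F G

theorem scale_one (s : R) : scale s 1 = 1 := map_one (scaleHom s)

theorem scale_smul (s : R) (c : ℂ) (F : GenAlg R) : scale s (c • F) = c • scale s F :=
  map_smul (scaleHom s) c F

theorem scale_prod {ι : Type*} (s : R) (t : Finset ι) (F : ι → GenAlg R) :
    scale s (∏ i ∈ t, F i) = ∏ i ∈ t, scale s (F i) :=
  map_prod (scaleHom s) F t

theorem scale_scale (s u : R) (F : GenAlg R) : scale s (scale u F) = scale (s * u) F := by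
  refine Subtype.ext (funext fun k ↦ ?_)
  have : (AddMonoidAlgebra.mapDomainAlgHom ℂ ℂ (AddMonoidHom.mulLeft (cls k s))).comp
      (AddMonoidAlgebra.mapDomainAlgHom ℂ ℂ (AddMonoidHom.mulLeft (cls k u))) =
      AddMonoidAlgebra.mapDomainAlgHom ℂ ℂ (AddMonoidHom.mulLeft (cls k (s * u))) := by
    rw [← AddMonoidAlgebra.mapDomainAlgHom_comp]
    congr 1
    ext A
    simp [mul_assoc]
  exact DFunLike.congr_fun this (F.1 k)

theorem scale_one_left (F : GenAlg R) : scale 1 F = F := by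
  refine Subtype.ext (funext fun k ↦ ?_)
  have : AddMonoidAlgebra.mapDomainAlgHom ℂ ℂ (AddMonoidHom.mulLeft (cls k (1 : R))) =
      AlgHom.id ℂ (GrpAlg R k) := by
    rw [← AddMonoidAlgebra.mapDomainAlgHom_id]
    congr 1
    ext A
    simp
  exact DFunLike.congr_fun this (F.1 k)

/-- The sum of the coefficients of an element of `ℂ[Γ_k]`. -/
def aug (k : ℕ) : GrpAlg R k →ₐ[ℂ] ℂ := AddMonoidAlgebra.lift ℂ ℂ (Lvl R k) 1

theorem aug_gam {k : ℕ} (A : Lvl R k) : aug k (gam A) = 1 := by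
  simp [aug, gam]

theorem aug_phi {j k : ℕ} (h : j ≤ k) (x : GrpAlg R k) : aug j (phi R h x) = aug k x := by
  induction x using AddMonoidAlgebra.induction_linear with
  | zero => simp
  | add x y hx hy => simp [hx, hy]
  | single A c =>
    have : (AddMonoidAlgebra.single A c : GrpAlg R k) = c • gam A := by simp [gam]
    rw [this, map_smul, map_smul, map_smul, phi_gam, aug_gam, aug_gam]

/-- The total mass of an element of `𝒢`. -/
def mass : GenAlg R →ₐ[ℂ] ℂ := (aug 0).comp (level 0)

theorem aug_level (k : ℕ) (F : GenAlg R) : aug k (F.1 k) = mass F := by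
  rw [← aug_phi (Nat.zero_le k), F.2 0 k (Nat.zero_le k)]
  rfl

theorem mass_scale (s : R) (F : GenAlg R) : mass (scale s F) = mass F := by
  change aug 0 (AddMonoidAlgebra.mapDomainAlgHom ℂ ℂ (AddMonoidHom.mulLeft (cls 0 s)) (F.1 0))
    = aug 0 (F.1 0)
  generalize F.1 0 = x
  induction x using AddMonoidAlgebra.induction_linear with
  | zero => simp
  | add x y hx hy => simp only [map_add, hx, hy]
  | single A c => simp [aug]

theorem coeff_zero_level_zero (F : GenAlg R) : (F.1 0).coeff 0 = mass F := by
  change _ = aug 0 (F.1 0)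
  have : Subsingleton (Lvl R 0) := by
    rw [Ideal.Quotient.subsingleton_iff, pow_zero, Ideal.one_eq_top]
  generalize F.1 0 = x
  induction x using AddMonoidAlgebra.induction_linear with
  | zero => simp
  | add x y hx hy => simp [hx, hy]
  | single A c => simp [aug, Subsingleton.elim A 0]

end Local

variable [IsDomain R] [IsDiscreteValuationRing R]

theorem cls_eq_zero {π : R} (hπ : Irreducible π) {k : ℕ} {a : R} : cls k a = 0 ↔ π ^ k ∣ a := by
  rw [Ideal.Quotient.eq_zero_iff_mem, hπ.maximalIdeal_eq, Ideal.span_singleton_pow,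
    Ideal.mem_span_singleton]

theorem proj_eq_zero_iff {π : R} (hπ : Irreducible π) {k : ℕ} (hk : 1 ≤ k) (A : Lvl R k) :
    proj R hk A = 0 ↔ ∃ B, A = cls k π * B := by
  obtain ⟨a, rfl⟩ := cls_surjective k A
  rw [proj_cls, cls_eq_zero hπ, pow_one]
  constructor
  · rintro ⟨b, rfl⟩
    exact ⟨cls k b, map_mul _ _ _⟩
  · rintro ⟨B, hB⟩
    obtain ⟨b, rfl⟩ := cls_surjective k B
    have : cls k (a - π * b) = 0 := by simp [hB]
    rw [cls_eq_zero hπ] at this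
    have h2 : π ∣ a - π * b := (dvd_pow_self π (by omega)).trans this
    simpa using h2.add (dvd_mul_right π b)

/-- Multiplication by `π` as an injection `R / π ^ k R → R / π ^ (k + 1) R`. -/
def mulUnif {π : R} (hπ : Irreducible π) (k : ℕ) : Lvl R k →+ Lvl R (k + 1) :=
  QuotientAddGroup.map _ (maximalIdeal R ^ (k + 1)).toAddSubgroup (AddMonoidHom.mulLeft π) (by
    intro a ha
    have h1 : π ^ k ∣ a := (cls_eq_zero hπ).1 (Ideal.Quotient.eq_zero_iff_mem.2 ha)
    have h2 : π ^ (k + 1) ∣ π * a := by rw [pow_succ']; exact mul_dvd_mul_left π h1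
    exact Ideal.Quotient.eq_zero_iff_mem.1 ((cls_eq_zero hπ).2 h2))

theorem mulUnif_cls {π : R} (hπ : Irreducible π) (k : ℕ) (a : R) :
    mulUnif hπ k (cls k a) = cls (k + 1) (π * a) := rfl

theorem mulUnif_injective {π : R} (hπ : Irreducible π) (k : ℕ) :
    Function.Injective (mulUnif hπ k) := by
  rw [injective_iff_map_eq_zero]
  intro A hA
  obtain ⟨a, rfl⟩ := cls_surjective k A
  rw [mulUnif_cls, cls_eq_zero hπ, pow_succ', mul_dvd_mul_iff_left hπ.ne_zero] at hA
  exact (cls_eq_zero hπ).2 hA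

theorem scale_unif_apply {π : R} (hπ : Irreducible π) (k : ℕ) (F : GenAlg R) :
    (scale π F).1 (k + 1) = AddMonoidAlgebra.mapDomainAlgHom ℂ ℂ (mulUnif hπ k) (F.1 k) :=
  scale_apply π F (Nat.le_succ k) _ (mulUnif_cls hπ k)

theorem coeff_scale_unif {π : R} (hπ : Irreducible π) (k : ℕ) (F : GenAlg R) :
    ((scale π F).1 (k + 1)).coeff 0 = (F.1 k).coeff 0 := by
  rw [scale_unif_apply hπ]
  generalize F.1 k = x
  induction x using AddMonoidAlgebra.induction_linear with
  | zero => simp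
  | add x y hx hy => simp only [map_add, AddMonoidAlgebra.coeff_add, Finsupp.add_apply, hx, hy]
  | single A c =>
    classical
    simp only [AddMonoidAlgebra.mapDomainAlgHom_apply, AddMonoidAlgebra.mapDomain_single,
      AddMonoidAlgebra.coeff_single, Finsupp.single_apply]
    congr 1
    exact propext (map_eq_zero_iff _ (mulUnif_injective hπ k))

theorem Ig_add (F G : GenAlg R) : Ig (F + G) = Ig F + Ig G := by
  ext k
  simp only [Ig, PowerSeries.coeff_mk, map_add, GenAlg.add_apply, AddMonoidAlgebra.coeff_add,
    Finsupp.add_apply]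
  ring

theorem Ig_smul (c : ℂ) (F : GenAlg R) : Ig (c • F) = c • Ig F := by
  ext k
  simp only [Ig, PowerSeries.coeff_mk, map_smul, GenAlg.smul_apply, AddMonoidAlgebra.coeff_smul,
    Finsupp.smul_apply, smul_eq_mul]
  ring

/-- All exponents gain a factor `π`. Multiplication by `π` embeds level `k` into level `k + 1`, so
the coefficients of `γ^0` shift by one level. The constant term vanishes because these coefficients
at levels 0 and 1 both equal the mass. -/
theorem Ig_scale_unif {π : R} (hπ : Irreducible π) (F : GenAlg R) :
    Ig (scale π F) = PowerSeries.X * Ig F := by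
  ext k
  cases k with
  | zero =>
    simp [Ig, coeff_zero_level_zero, coeff_scale_unif hπ, mass_scale]
  | succ k =>
    rw [PowerSeries.coeff_succ_X_mul]
    simp [Ig, coeff_scale_unif hπ]

end Algebra

/-! ### Points `z^a`, the uniform element `z^R` and cosets -/

noncomputable section Uniform

variable {R : Type*} [CommRing R] [IsDomain R] [IsDiscreteValuationRing R]
  [Finite (ResidueField R)]

theorem resCard_pos : 0 < resCard R := Nat.card_pos

theorem one_lt_resCard : 1 < resCard R := Finite.one_lt_card

theorem resCard_ne_zero : (resCard R : ℂ) ≠ 0 := by exact_mod_cast resCard_pos.ne'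

theorem card_univ_lvl (k : ℕ) : (Finset.univ : Finset (Lvl R k)).card = resCard R ^ k := by
  rw [Finset.card_univ, ← Nat.card_eq_fintype_card, card_lvl]

/-- `z ^ a`. -/
def zPt (a : R) : GenAlg R := zCoset a ⊥

theorem zPt_apply (a : R) (k : ℕ) : (zPt a).1 k = gam (cls k a) := by
  classical
  have : (Finset.univ.filter (fun C : Lvl R k ↦ ∃ x ∈ (⊥ : Ideal R), cls k (a + x) = C)) =
      {cls k a} := by
    ext C
    rw [Finset.mem_filter, Finset.mem_singleton]
    constructor
    · rintro ⟨-, x, hx, rfl⟩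
      rw [(Submodule.mem_bot R).1 hx, add_zero]
    · rintro rfl
      exact ⟨Finset.mem_univ _, 0, Submodule.zero_mem _, by rw [add_zero]⟩
  simp only [zPt, zCoset]
  rw [show (Finset.univ.filter (fun C : Lvl R k ↦ ∃ x ∈ (⊥ : Ideal R), cls k (a + x) = C)) =
      {cls k a} from this]
  simp

theorem zPt_add (a b : R) : zPt (a + b) = zPt a * zPt b :=
  Subtype.ext (funext fun k ↦ by
    rw [GenAlg.mul_apply, zPt_apply, zPt_apply, zPt_apply, gam_mul_gam, cls_add])

theorem zPt_zero : zPt (0 : R) = 1 :=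
  Subtype.ext (funext fun k ↦ by rw [zPt_apply, cls_zero]; rfl)

theorem mass_zPt (a : R) : mass (zPt a) = 1 := by
  rw [← aug_level 0, zPt_apply, aug_gam]

theorem scale_zPt (s a : R) : scale s (zPt a) = zPt (s * a) :=
  Subtype.ext (funext fun k ↦ by
    change AddMonoidAlgebra.mapDomainAlgHom ℂ ℂ (AddMonoidHom.mulLeft (cls k s)) ((zPt a).1 k) = _
    rw [zPt_apply, zPt_apply, mapDomain_gam, cls_mul]
    rfl)

/-- `z ^ R`. -/
def zUnif (R : Type*) [CommRing R] [IsDomain R] [IsDiscreteValuationRing R]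
    [Finite (ResidueField R)] : GenAlg R := zCoset 0 ⊤

theorem zUnif_apply (k : ℕ) :
    (zUnif R).1 k = ((resCard R : ℂ) ^ k)⁻¹ • ∑ C : Lvl R k, gam C := by
  classical
  have : (Finset.univ.filter (fun C : Lvl R k ↦ ∃ x ∈ (⊤ : Ideal R), cls k (0 + x) = C)) =
      Finset.univ := by
    ext C
    obtain ⟨c, rfl⟩ := cls_surjective k C
    simp
  simp only [zUnif, zCoset]
  rw [show (Finset.univ.filter (fun C : Lvl R k ↦ ∃ x ∈ (⊤ : Ideal R), cls k (0 + x) = C)) =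
      Finset.univ from this, card_univ_lvl, Nat.cast_pow]

theorem mass_zUnif : mass (zUnif R) = 1 := by
  rw [← aug_level 0, zUnif_apply]
  simp only [map_smul, map_sum, aug_gam, Finset.sum_const, card_univ_lvl]
  simp

/-- The sum of all `γ^C` is invariant under translation, so each `γ^A` acts on it as 1. -/
theorem mul_zUnif (F : GenAlg R) : F * zUnif R = mass F • zUnif R := by
  refine Subtype.ext (funext fun k ↦ ?_)
  rw [GenAlg.mul_apply, GenAlg.smul_apply, ← aug_level k, zUnif_apply, mul_smul_comm,
    smul_comm (aug k _)]
  congr 1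
  generalize F.1 k = x
  induction x using AddMonoidAlgebra.induction_linear with
  | zero => simp
  | add x y hx hy => rw [add_mul, hx, hy, map_add, add_smul]
  | single A c =>
    have : (AddMonoidAlgebra.single A c : GrpAlg R k) = c • gam A := by simp [gam]
    rw [this, map_smul, aug_gam, smul_mul_assoc, Finset.mul_sum]
    simp only [gam_mul_gam, smul_eq_mul, mul_one]
    congr 1
    exact Fintype.sum_equiv (Equiv.addLeft A) _ _ fun _ ↦ rfl

theorem scale_mul_scale_zUnif (s : R) (F : GenAlg R) :
    scale s F * scale s (zUnif R) = mass F • scale s (zUnif R) := by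
  rw [← scale_mul, mul_zUnif, scale_smul]

theorem scale_zUnif_apply (s : R) (k : ℕ) : (scale s (zUnif R)).1 k =
    ((resCard R : ℂ) ^ k)⁻¹ • ∑ C : Lvl R k, gam (cls k s * C) := by
  change AddMonoidAlgebra.mapDomainAlgHom ℂ ℂ (AddMonoidHom.mulLeft (cls k s)) ((zUnif R).1 k) = _
  rw [zUnif_apply, map_smul, map_sum]
  simp only [mapDomain_gam]
  rfl

/-- With this a missing linear form and a zero coefficient need no separate treatment: both are the
case `b = 0` of `z^(bR)`. -/
theorem scale_zero_zUnif : scale 0 (zUnif R) = 1 := by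
  refine Subtype.ext (funext fun k ↦ ?_)
  rw [scale_zUnif_apply]
  simp only [map_zero, zero_mul, gam_zero, Finset.sum_const, card_univ_lvl, GenAlg.one_apply]
  rw [← Nat.cast_smul_eq_nsmul ℂ, smul_smul, Nat.cast_pow,
    inv_mul_cancel₀ (pow_ne_zero _ resCard_ne_zero), one_smul]

theorem scale_dvd_zUnif {s u : R} (h : s ∣ u) :
    scale u (zUnif R) * scale s (zUnif R) = scale s (zUnif R) := by
  obtain ⟨v, rfl⟩ := h
  rw [← scale_scale, scale_mul_scale_zUnif, mass_scale, mass_zUnif, one_smul]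

theorem scale_unit_zUnif {u : R} (hu : IsUnit u) : scale u (zUnif R) = zUnif R := by
  have h1 := scale_dvd_zUnif (s := 1) (u := u) (one_dvd u)
  have h2 := scale_dvd_zUnif (s := u) (u := 1) hu.dvd
  rw [scale_one_left] at h1 h2
  rw [← h2, mul_comm, h1]

theorem zPt_mul_scale_zUnif {s a : R} (h : s ∣ a) :
    zPt a * scale s (zUnif R) = scale s (zUnif R) := by
  obtain ⟨v, rfl⟩ := h
  rw [← scale_zPt, scale_mul_scale_zUnif, mass_zPt, one_smul]

/-- Averages over the source and the image of an additive homomorphism correspond. -/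
theorem avg_image {X Y M : Type*} [AddCommGroup X] [AddCommGroup Y] [Fintype X] [AddCommGroup M]
    [Module ℂ M] [DecidableEq Y] (f : X →+ Y) (U : Finset Y) (hU : ∀ y, y ∈ U ↔ ∃ x, f x = y)
    (g : Y → M) :
    ((Fintype.card X : ℂ))⁻¹ • ∑ x, g (f x) = ((U.card : ℂ))⁻¹ • ∑ y ∈ U, g y := by
  refine (avg_fiber (M := M) Finset.univ U f g (Finset.univ.filter (fun x ↦ f x = 0)).card
    (Finset.card_pos.2 ⟨0, by simp⟩).ne' (fun x _ ↦ (hU _).2 ⟨x, rfl⟩) fun y hy ↦ ?_).2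
  exact AddMonoidHom.card_fiber_eq_of_mem_range f ((hU y).1 hy) ⟨0, map_zero f⟩

/-- Modulo `π^k` the coset is the translate by `a` of the image of multiplication by `s`. All fibres
of that map have equal size, so averaging over the image is averaging over the source. -/
theorem zCoset_span (a s : R) : zCoset a (Ideal.span {s}) = zPt a * scale s (zUnif R) := by
  classical
  refine Subtype.ext (funext fun k ↦ ?_)
  rw [GenAlg.mul_apply, zPt_apply, scale_zUnif_apply, mul_smul_comm, Finset.mul_sum]
  simp only [gam_mul_gam]
  set U := Finset.univ.filter (fun C : Lvl R k ↦ ∃ x ∈ Ideal.span {s}, cls k (a + x) = C) with hU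
  set V := Finset.univ.filter (fun C : Lvl R k ↦ ∃ B, AddMonoidHom.mulLeft (cls k s) B = C) with hV
  have h1 := avg_image (AddMonoidHom.mulLeft (cls k s)) V
    (fun C ↦ by rw [hV, Finset.mem_filter]; simp only [Finset.mem_univ, true_and])
    (fun C ↦ (gam (cls k a + C) : GrpAlg R k))
  rw [← Nat.card_eq_fintype_card, card_lvl, Nat.cast_pow] at h1
  refine Eq.trans ?_ h1.symm
  have h2 : V.image (fun C ↦ cls k a + C) = U := by
    ext C
    simp only [hU, hV, Finset.mem_image, Finset.mem_filter, Finset.mem_univ, true_and]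
    constructor
    · rintro ⟨_, ⟨B, rfl⟩, rfl⟩
      obtain ⟨b, rfl⟩ := cls_surjective k B
      exact ⟨s * b, Ideal.mem_span_singleton.2 (dvd_mul_right _ _), by simp⟩
    · rintro ⟨x, hx, rfl⟩
      obtain ⟨b, rfl⟩ := Ideal.mem_span_singleton.1 hx
      exact ⟨_, ⟨cls k b, rfl⟩, by simp⟩
  change (U.card : ℂ)⁻¹ • ∑ C ∈ U, gam C = _
  rw [← h2, Finset.card_image_of_injective _ (add_right_injective _),
    Finset.sum_image (fun _ _ _ _ h ↦ add_right_injective _ h)]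

theorem zCoset_pow {π : R} (hπ : Irreducible π) (a : R) (n : ℕ) :
    zCoset a (maximalIdeal R ^ n) = zPt a * scale (π ^ n) (zUnif R) := by
  have h : maximalIdeal R ^ n = Ideal.span {π ^ n} := by
    rw [hπ.maximalIdeal_eq, Ideal.span_singleton_pow]
  exact (congrArg (zCoset a) h).trans (zCoset_span a _)

theorem Ig_zUnif : Ig (zUnif R) = linZeta R := by
  have hc : ∀ k, ((zUnif R).1 k).coeff 0 = ((resCard R : ℂ) ^ k)⁻¹ := by
    intro k
    classical
    simp [zUnif_apply, Finsupp.single_apply]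
  have h0 : PowerSeries.constantCoeff (1 - (resCard R : ℂ)⁻¹ • (PowerSeries.X : PowerSeries ℂ))
      ≠ 0 := by simp [PowerSeries.smul_eq_C_mul]
  rw [linZeta, PowerSeries.smul_eq_C_mul, PowerSeries.eq_mul_inv_iff_mul_eq h0, mul_sub, mul_one]
  ext k
  rw [map_sub, mul_smul_comm, map_smul]
  cases k with
  | zero => simp [Ig, hc]
  | succ k =>
    rw [PowerSeries.coeff_succ_mul_X, PowerSeries.coeff_C]
    have := resCard_ne_zero (R := R)
    simp only [Ig, PowerSeries.coeff_mk, hc, smul_eq_mul]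
    rw [if_neg (Nat.succ_ne_zero k)]
    field_simp
    ring

/-- Every exponent has the form `u + π x`, a unit, so no `γ^0` occurs at positive levels and only
the mass at level 0 survives. -/
theorem Ig_zPt_mul_scale {π : R} (hπ : Irreducible π) {u : R} (hu : IsUnit u) (F : GenAlg R) :
    Ig (zPt u * scale π F) = mass F • 1 := by
  have hc : ∀ k, ((zPt u * scale π F).1 (k + 1)).coeff 0 = 0 := by
    intro k
    rw [GenAlg.mul_apply, zPt_apply, scale_unif_apply hπ]
    generalize F.1 k = x
    induction x using AddMonoidAlgebra.induction_linear with
    | zero => simp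
    | add x y hx hy =>
      rw [map_add, mul_add, AddMonoidAlgebra.coeff_add, Finsupp.add_apply, hx, hy, add_zero]
    | single A c =>
      obtain ⟨a, rfl⟩ := cls_surjective k A
      have : cls (k + 1) u + mulUnif hπ k (cls k a) ≠ 0 := by
        rw [mulUnif_cls, ← map_add, Ne, cls_eq_zero hπ]
        intro h
        have h1 : π ∣ u + π * a := (dvd_pow_self π (by omega)).trans h
        exact hπ.not_isUnit (isUnit_of_dvd_unit ((dvd_add_left (dvd_mul_right π a)).1 h1) hu)
      simp [gam, AddMonoidAlgebra.single_mul_single, this]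
  ext k
  cases k with
  | zero =>
    rw [Ig, PowerSeries.coeff_mk, hc, coeff_zero_level_zero, map_mul, mass_zPt, mass_scale]
    simp
  | succ k =>
    rw [Ig, PowerSeries.coeff_mk, hc, hc]
    simp [PowerSeries.coeff_one]

end Uniform

/-! ### Quadratic forms and their generating functions -/

noncomputable section Forms

variable {R : Type*} [CommRing R]

theorem QForm.aeval_poly {S : Type*} [CommRing S] [Algebra R S] (P : QForm R) (A : P.ι → S) :
    MvPolynomial.aeval A P.poly = ∑ i, ∑ j, algebraMap R S (P.mat i j) * A i * A j := by
  simp [QForm.poly]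

/-- Taylor expansion. The symmetry of the matrix identifies the two mixed sums, whence the factor 2
that brings `ℓ` into the theory. -/
theorem QForm.aeval_poly_add {S : Type*} [CommRing S] [Algebra R S] (P : QForm R) (s : S)
    (A y : P.ι → S) :
    MvPolynomial.aeval (A + s • y) P.poly = MvPolynomial.aeval A P.poly
      + 2 * s * ∑ i, (∑ j, algebraMap R S (P.mat i j) * A j) * y i
      + s ^ 2 * MvPolynomial.aeval y P.poly := by
  have h : ∑ i, ∑ j, algebraMap R S (P.mat i j) * (A i * (s * y j)) =
      s * ∑ i, (∑ j, algebraMap R S (P.mat i j) * A j) * y i := by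
    rw [Finset.sum_comm, Finset.mul_sum]
    refine Finset.sum_congr rfl fun i _ ↦ ?_
    rw [Finset.sum_mul, Finset.mul_sum]
    refine Finset.sum_congr rfl fun j _ ↦ ?_
    rw [P.symm.apply i j]
    ring
  have h' : ∑ i, ∑ j, algebraMap R S (P.mat i j) * (s * y i * A j) =
      s * ∑ i, (∑ j, algebraMap R S (P.mat i j) * A j) * y i := by
    rw [Finset.mul_sum]
    refine Finset.sum_congr rfl fun i _ ↦ ?_
    rw [Finset.sum_mul, Finset.mul_sum]
    refine Finset.sum_congr rfl fun j _ ↦ ?_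
    ring
  rw [show 2 * s * ∑ i, (∑ j, algebraMap R S (P.mat i j) * A j) * y i =
    s * (∑ i, (∑ j, algebraMap R S (P.mat i j) * A j) * y i) +
      s * (∑ i, (∑ j, algebraMap R S (P.mat i j) * A j) * y i) by ring]
  nth_rewrite 1 [← h]
  rw [← h', QForm.aeval_poly, QForm.aeval_poly, QForm.aeval_poly]
  simp only [Finset.mul_sum, ← Finset.sum_add_distrib]
  refine Finset.sum_congr rfl fun i _ ↦ Finset.sum_congr rfl fun j _ ↦ ?_
  simp only [Pi.add_apply, Pi.smul_apply, smul_eq_mul]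
  ring

theorem QForm.aeval_poly_smul {S : Type*} [CommRing S] [Algebra R S] (P : QForm R) (s : S)
    (y : P.ι → S) :
    MvPolynomial.aeval (s • y) P.poly = s ^ 2 * MvPolynomial.aeval y P.poly := by
  rw [QForm.aeval_poly, QForm.aeval_poly]
  simp only [Finset.mul_sum]
  refine Finset.sum_congr rfl fun i _ ↦ Finset.sum_congr rfl fun j _ ↦ ?_
  simp only [Pi.smul_apply, smul_eq_mul]
  ring

theorem QForm.aeval_smul_poly {S : Type*} [CommRing S] [Algebra R S] (P : QForm R) (a : R)
    (A : P.ι → S) :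
    MvPolynomial.aeval A (P.smul a).poly = algebraMap R S a * MvPolynomial.aeval A P.poly := by
  refine ((P.smul a).aeval_poly A).trans ?_
  rw [QForm.aeval_poly]
  simp only [Finset.mul_sum]
  refine Finset.sum_congr rfl fun i _ ↦ Finset.sum_congr rfl fun j _ ↦ ?_
  change algebraMap R S (a * P.mat i j) * A i * A j = _
  rw [map_mul]
  ring

theorem QForm.aeval_directSum_poly {S : Type*} [CommRing S] [Algebra R S] (s : Finset ℕ)
    (Q : ℕ → QForm R) (A : (QForm.directSum s Q).ι → S) :
    MvPolynomial.aeval A (QForm.directSum s Q).poly =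
      ∑ i : s, MvPolynomial.aeval (fun x ↦ A ⟨i, x⟩) (Q i).poly := by
  rw [QForm.aeval_poly]
  change ∑ x : (Σ i : s, (Q i).ι), ∑ y : (Σ i : s, (Q i).ι), algebraMap R S
    (Matrix.blockDiagonal' (fun i : s ↦ (Q i).mat) x y) * A x * A y = _
  rw [Fintype.sum_sigma]
  refine Finset.sum_congr rfl fun i _ ↦ ?_
  rw [QForm.aeval_poly]
  refine Finset.sum_congr rfl fun x _ ↦ ?_
  rw [Fintype.sum_sigma, Finset.sum_eq_single i]
  · simp only [Matrix.blockDiagonal'_apply_eq]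
  · intro j _ hj
    refine Finset.sum_eq_zero fun y _ ↦ ?_
    rw [Matrix.blockDiagonal'_apply_ne _ _ _ hj.symm]
    simp
  · simp

theorem QForm.rank_directSum (s : Finset ℕ) (Q : ℕ → QForm R) :
    (QForm.directSum s Q).rank = ∑ i ∈ s, (Q i).rank := by
  change Fintype.card (Σ i : s, (Q i).ι) = _
  rw [Fintype.card_sigma]
  exact Finset.sum_coe_sort s fun i ↦ (Q i).rank

theorem QForm.unimodular_directSum (s : Finset ℕ) (Q : ℕ → QForm R)
    (h : ∀ i, (Q i).Unimodular) : (QForm.directSum s Q).Unimodular := by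
  change IsUnit (Matrix.blockDiagonal' fun i : s ↦ (Q i).mat).det
  rw [← Matrix.isUnit_iff_isUnit_det]
  have hu : IsUnit (fun i : s ↦ (Q i).mat) :=
    Pi.isUnit_iff.2 fun i ↦ (Matrix.isUnit_iff_isUnit_det _).2 (h i)
  exact hu.map (Matrix.blockDiagonal'RingHom (fun i : s ↦ (Q i).ι) R)

theorem QForm.zero_poly : (QForm.zero R).poly = 0 := by
  have : IsEmpty (QForm.zero R).ι := inferInstanceAs (IsEmpty Empty)
  simp [QForm.poly]

/-- Otherwise all entries of `M a` lie in the maximal ideal, and then so do those of `a = M⁻¹ (M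
a)`. -/
theorem exists_isUnit_mulVec [IsLocalRing R] {P : QForm R} (hP : P.Unimodular) {a : P.ι → R}
    (ha : ∃ h, IsUnit (a h)) : ∃ i, IsUnit (∑ j, P.mat i j * a j) := by
  by_contra! hc
  obtain ⟨h, hh⟩ := ha
  have h1 : P.mat⁻¹.mulVec (P.mat.mulVec a) = a := by
    rw [Matrix.mulVec_mulVec, Matrix.nonsing_inv_mul _ hP, Matrix.one_mulVec]
  have h2 : a h ∈ maximalIdeal R := by
    rw [← h1]
    exact Ideal.sum_mem _ fun i _ ↦ Ideal.mul_mem_left _ _ ((mem_maximalIdeal _).2 (hc i))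
  exact (mem_maximalIdeal _).1 h2 hh

variable [IsDomain R] [IsDiscreteValuationRing R] [Finite (ResidueField R)]

theorem genFun_apply {σ : Type*} [Fintype σ] [DecidableEq σ] (f : MvPolynomial σ R) (k : ℕ) :
    (genFun f).1 k = ((resCard R : ℂ) ^ (Fintype.card σ * k))⁻¹ •
      ∑ A : σ → Lvl R k, gam (MvPolynomial.aeval A f) := by
  simp only [genFun, modGen]
  congr!

theorem genFun_zero {σ : Type*} [Fintype σ] : genFun (0 : MvPolynomial σ R) = 1 := by
  classical
  refine Subtype.ext (funext fun k ↦ ?_)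
  rw [genFun_apply]
  simp only [map_zero, gam_zero, Finset.sum_const, GenAlg.one_apply]
  have : (Finset.univ : Finset (σ → Lvl R k)).card = resCard R ^ (Fintype.card σ * k) := by
    rw [Finset.card_univ, Fintype.card_fun, ← Nat.card_eq_fintype_card, card_lvl, ← pow_mul,
      mul_comm]
  rw [← Nat.cast_smul_eq_nsmul ℂ, smul_smul, this, Nat.cast_pow,
    inv_mul_cancel₀ (pow_ne_zero _ resCard_ne_zero), one_smul]

theorem mass_genFun {σ : Type*} [Fintype σ] (f : MvPolynomial σ R) : mass (genFun f) = 1 := by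
  classical
  rw [← aug_level 0, genFun_apply]
  simp only [map_smul, map_sum, aug_gam, Finset.sum_const, Finset.card_univ, Fintype.card_fun]
  rw [← Nat.card_eq_fintype_card (α := Lvl R 0), card_lvl]
  simp

theorem genFun_smul_poly (P : QForm R) (a : R) :
    genFun (P.smul a).poly = scale a (genFun P.poly) := by
  refine Subtype.ext (funext fun k ↦ ?_)
  change _ = AddMonoidAlgebra.mapDomainAlgHom ℂ ℂ (AddMonoidHom.mulLeft (cls k a))
    ((genFun P.poly).1 k)
  rw [genFun_apply, genFun_apply, map_smul, map_sum]
  simp only [mapDomain_gam]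
  congr 1
  exact Finset.sum_congr rfl fun A _ ↦ congrArg gam (P.aeval_smul_poly a A)

theorem genFun_directSum (s : Finset ℕ) (Q : ℕ → QForm R) :
    genFun (QForm.directSum s Q).poly = ∏ i ∈ s, genFun (Q i).poly := by
  refine Subtype.ext (funext fun k ↦ ?_)
  rw [← Finset.prod_coe_sort]
  change _ = level k _
  rw [map_prod, genFun_apply]
  simp only [level_apply, genFun_apply]
  rw [Finset.prod_smul, Finset.prod_univ_sum, Fintype.piFinset_univ, Finset.prod_inv_distrib,
    Finset.prod_pow_eq_pow_sum, ← Finset.sum_mul]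
  simp only [prod_gam]
  congr 1
  · congr 3
    exact Fintype.card_sigma
  · refine Fintype.sum_equiv (Equiv.piCurry fun (i : s) (_ : (Q i).ι) ↦ Lvl R k) _ _ fun A ↦ ?_
    exact congrArg gam (QForm.aeval_directSum_poly s Q A)

theorem genFun_quadPoly (π : R) (ω : ℕ) (Q : ℕ → QForm R) {m : ℕ} (b : Fin m → R) (c : R) :
    genFun (quadPoly π ω Q b c) = zPt c * (∏ j, scale (b j) (zUnif R)) *
      ∏ i ∈ Finset.range (ω + 1), scale (π ^ i) (genFun (Q i).poly) := by
  simp only [← genFun_smul_poly]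
  rw [← genFun_directSum _ fun i ↦ (Q i).smul (π ^ i)]
  unfold quadPoly
  generalize QForm.directSum (Finset.range (ω + 1)) (fun i ↦ (Q i).smul (π ^ i)) = P
  refine Subtype.ext (funext fun k ↦ ?_)
  rw [GenAlg.mul_apply, GenAlg.mul_apply, zPt_apply]
  change _ = _ * level k _ * _
  rw [map_prod, genFun_apply, genFun_apply]
  simp only [level_apply, scale_zUnif_apply]
  rw [Finset.prod_smul, Finset.prod_univ_sum, Fintype.piFinset_univ, Finset.prod_inv_distrib,
    Finset.prod_const, Finset.card_univ, Fintype.card_fin, mul_smul_comm, mul_smul_comm,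
    smul_mul_assoc, smul_smul, ← mul_inv]
  simp only [Finset.mul_sum, Finset.sum_mul]
  rw [← Fintype.sum_prod_type']
  congr 1
  · congr 1
    rw [Fintype.card_sum, Fintype.card_fin, ← pow_mul, ← pow_add]
    ring_nf
  · refine Fintype.sum_equiv (Equiv.sumArrowEquivProdArrow P.ι (Fin m) (Lvl R k)) _ _
      fun A ↦ ?_
    simp only [prod_gam, gam_mul_gam]
    congr 1
    simp only [map_add, MvPolynomial.aeval_rename, map_sum, map_mul, MvPolynomial.aeval_C,
      MvPolynomial.aeval_X]
    rw [add_comm, add_comm (MvPolynomial.aeval (A ∘ Sum.inl) P.poly), ← add_assoc]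
    rfl

end Forms

/-! ### Heads of unimodular forms -/

noncomputable section Head

variable {R : Type*} [CommRing R] [IsDomain R] [IsDiscreteValuationRing R]
  [Finite (ResidueField R)]

theorem card_fun_lvl (ι : Type*) [Fintype ι] [DecidableEq ι] (k : ℕ) :
    Fintype.card (ι → Lvl R k) = resCard R ^ (Fintype.card ι * k) := by
  rw [Fintype.card_fun, ← Nat.card_eq_fintype_card (α := Lvl R k), card_lvl, ← pow_mul, mul_comm]

open Classical in
/-- The primitive vectors over `R / π ^ k R`. -/
def primVec (R : Type*) [CommRing R] [IsDomain R] [IsDiscreteValuationRing R]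
    [Finite (ResidueField R)] (ι : Type*) [Fintype ι] {k : ℕ} (hk : 1 ≤ k) :
    Finset (ι → Lvl R k) :=
  Finset.univ.filter fun A ↦ ¬ ∀ h, proj R hk (A h) = 0

theorem mem_primVec {ι : Type*} [Fintype ι] {k : ℕ} {hk : 1 ≤ k} {A : ι → Lvl R k} :
    A ∈ primVec R ι hk ↔ ¬ ∀ h, proj R hk (A h) = 0 := by
  simp [primVec]

/-- The condition `1 ≤ k` is needed for a class modulo `π^k` to lie either inside or outside the
region of primitive vectors. -/
theorem head_apply {ι : Type*} [Fintype ι] (f : MvPolynomial ι R) {k : ℕ} (hk : 1 ≤ k) :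
    (head f).1 k = ((resCard R : ℂ) ^ (Fintype.card ι * k))⁻¹ •
      ∑ A ∈ primVec R ι hk, gam (MvPolynomial.aeval A f) := by
  classical
  refine (partGen_apply f (headRegion R ι) 1 (isRegular_headRegion R ι) k hk).trans ?_
  unfold partMod
  congr 1
  refine Finset.sum_congr ?_ fun _ _ ↦ rfl
  ext A
  rw [Finset.mem_filter, mem_primVec]
  have hm : ∀ x : R, x ∈ maximalIdeal R ↔ cls 1 x = 0 := fun x ↦ by
    rw [Ideal.Quotient.eq_zero_iff_mem, pow_one]
  constructor
  · rintro ⟨-, hA⟩ h0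
    choose a ha using fun h ↦ cls_surjective k (A h)
    refine hA (show a ∈ _ from ha) fun h ↦ ?_
    rw [hm, ← proj_cls hk, ha, h0]
  · refine fun hA ↦ ⟨Finset.mem_univ _, fun x hx h0 ↦ hA fun h ↦ ?_⟩
    rw [← hx h, proj_cls, ← hm]
    exact h0 h

/-- Coordinatewise reduction modulo `π`. -/
def projVec (R : Type*) [CommRing R] [IsLocalRing R] (ι : Type*) {k : ℕ} (hk : 1 ≤ k) :
    (ι → Lvl R k) →+ (ι → Lvl R 1) :=
  (proj R hk).toAddMonoidHom.compLeft ι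

/-- The imprimitive vectors are the `π B`, with `P(π B) = π^2 P(B)`. They make up the fraction
`q^(-r)` of all vectors. -/
theorem genFun_eq_head_add {π : R} (hπ : Irreducible π) (P : QForm R) :
    genFun P.poly = head P.poly
      + ((resCard R : ℂ) ^ P.rank)⁻¹ • scale (π ^ 2) (genFun P.poly) := by
  classical
  refine GenAlg.ext_of_le 1 fun k hk ↦ ?_
  rw [GenAlg.add_apply, GenAlg.smul_apply, genFun_apply, head_apply _ hk]
  change _ = _ + _ • AddMonoidAlgebra.mapDomainAlgHom ℂ ℂ (AddMonoidHom.mulLeft (cls k (π ^ 2)))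
    ((genFun P.poly).1 k)
  rw [genFun_apply, map_smul, map_sum]
  simp only [mapDomain_gam]
  set U : Finset (P.ι → Lvl R k) := Finset.univ.filter fun A ↦ ∀ h, proj R hk (A h) = 0 with hU
  have h1 : ∑ A : P.ι → Lvl R k, (gam (MvPolynomial.aeval A P.poly) : GrpAlg R k) =
      ∑ A ∈ primVec R P.ι hk, gam (MvPolynomial.aeval A P.poly)
        + ∑ A ∈ U, gam (MvPolynomial.aeval A P.poly) := by
    rw [add_comm, primVec]
    convert (Finset.sum_filter_add_sum_filter_not Finset.univ
      (fun A : P.ι → Lvl R k ↦ ∀ h, proj R hk (A h) = 0) _).symm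
  rw [h1, smul_add]
  congr 1
  have h2 := avg_image (AddMonoidHom.mulLeft (fun _ : P.ι ↦ cls k π)) U (fun A ↦ by
    rw [hU, Finset.mem_filter]
    simp only [Finset.mem_univ, true_and, proj_eq_zero_iff hπ]
    constructor
    · intro h
      choose B hB using h
      exact ⟨B, funext fun i ↦ (hB i).symm⟩
    · rintro ⟨B, rfl⟩ h
      exact ⟨B h, rfl⟩) (fun A ↦ (gam (MvPolynomial.aeval A P.poly) : GrpAlg R k))
  have h3 : ∀ A : P.ι → Lvl R k,
      MvPolynomial.aeval (AddMonoidHom.mulLeft (fun _ : P.ι ↦ cls k π) A) P.poly =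
        AddMonoidHom.mulLeft (cls k (π ^ 2)) (MvPolynomial.aeval A P.poly) := by
    intro A
    refine (P.aeval_poly_smul (cls k π) A).trans ?_
    rw [← map_pow]
    rfl
  simp only [h3] at h2
  -- Reduction modulo `π` is onto with kernel `U`, so all its fibres have `U.card` elements.
  have h4 : (Fintype.card (P.ι → Lvl R k)) = U.card * Fintype.card (P.ι → Lvl R 1) := by
    refine (avg_fiber (M := ℂ) Finset.univ Finset.univ (projVec R P.ι hk) (fun _ ↦ 0) U.card
      (Finset.card_pos.2 ⟨0, by simp [hU]⟩).ne' (fun _ _ ↦ Finset.mem_univ _) fun B _ ↦ ?_).1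
    have hs : Function.Surjective (projVec R P.ι hk) := fun B ↦ by
      choose b hb using fun h ↦ cls_surjective 1 (B h)
      exact ⟨fun h ↦ cls k (b h), funext hb⟩
    rw [AddMonoidHom.card_fiber_eq_of_mem_range _ (hs B) (hs 0)]
    congr 1
    ext A
    simp [hU, funext_iff, projVec]
  rw [card_fun_lvl, card_fun_lvl, mul_one] at h4
  rw [card_fun_lvl, Nat.cast_pow] at h2
  rw [h2, smul_smul, QForm.rank, ← mul_inv]
  congr 2
  have h5 : ((resCard R ^ (Fintype.card P.ι * k) : ℕ) : ℂ)
      = (U.card * resCard R ^ Fintype.card P.ι : ℕ) := congrArg Nat.cast h4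
  push_cast at h5
  rw [h5, mul_comm]

/-- Perturb a primitive `A` by `π^m y` with `m = k - 1 - l`. The value changes by `2 π^m (M A)·y`
alone, since the quadratic term has valuation at least `2m ≥ k`; this is where `k ≥ 2l + 2` is used.
As `2 π^m` has valuation `k - 1` and `M A` has a unit entry, the change takes every value in
`π^(k-1) R / π^k R`. Averaging over `y` thus makes the head invariant under translation by these
values. -/
theorem head_mul_gam {π : R} (hπ : Irreducible π) {l : ℕ} (h2 : Associated (π ^ l) 2)
    {P : QForm R} (hP : P.Unimodular) {k : ℕ} (hk : 2 * l + 2 ≤ k) (d : R) :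
    (head P.poly).1 k * gam (cls k (π ^ (k - 1) * d)) = (head P.poly).1 k := by
  classical
  have hk1 : 1 ≤ k := by omega
  rw [head_apply _ hk1, smul_mul_assoc]
  congr 1
  set T : GrpAlg R k := ∑ A ∈ primVec R P.ι hk1, gam (MvPolynomial.aeval A P.poly) with hT
  set m := k - 1 - l with hm
  let B : (P.ι → Lvl R k) → (P.ι → Lvl R k) → Lvl R k := fun A y ↦
    2 * cls k (π ^ m) * ∑ i, (∑ j, algebraMap R (Lvl R k) (P.mat i j) * A j) * y i
  have hB : ∀ A y, MvPolynomial.aeval (A + cls k (π ^ m) • y) P.poly =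
      MvPolynomial.aeval A P.poly + B A y := by
    intro A y
    have : cls k (π ^ m) ^ 2 = 0 := by
      rw [← map_pow, cls_eq_zero hπ, ← pow_mul]
      exact pow_dvd_pow _ (by omega)
    rw [QForm.aeval_poly_add, this, zero_mul, add_zero]
  have hBadd : ∀ A y y', B A (y + y') = B A y + B A y' := by
    intro A y y'
    simp only [B, Pi.add_apply, mul_add, Finset.sum_add_distrib]
  have hex : ∀ A ∈ primVec R P.ι hk1, ∃ y, B A y = cls k (π ^ (k - 1) * d) := by
    intro A hA
    choose a ha using fun h ↦ cls_surjective k (A h)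
    have hu : ∃ h, IsUnit (a h) := by
      rw [mem_primVec] at hA
      push Not at hA
      obtain ⟨h, hh⟩ := hA
      refine ⟨h, by_contra fun hn ↦ hh ?_⟩
      rw [← ha, proj_cls, Ideal.Quotient.eq_zero_iff_mem, pow_one]
      exact (mem_maximalIdeal _).2 hn
    obtain ⟨i, u, hi⟩ := exists_isUnit_mulVec hP hu
    obtain ⟨e, he⟩ := h2
    -- One coordinate suffices: `u` is the unit entry of `M A` and `2 = π^l e`, so dividing by both
    -- units leaves `π^l π^m d = π^(k-1) d`.
    refine ⟨Pi.single i (cls k ((u⁻¹ : Rˣ) * (e⁻¹ : Rˣ) * d)), ?_⟩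
    have h1 : ∑ j, algebraMap R (Lvl R k) (P.mat i j) * A j = cls k (u : R) := by
      rw [hi]
      refine Eq.trans ?_ (map_sum (Ideal.Quotient.mk _) _ _).symm
      refine Finset.sum_congr rfl fun j _ ↦ ?_
      rw [map_mul, ← ha]
      rfl
    have h3 : (2 : Lvl R k) = cls k (π ^ l * e) := by rw [he]; rfl
    simp only [B]
    rw [Finset.sum_eq_single i (fun j _ hj ↦ by rw [Pi.single_eq_of_ne hj, mul_zero]) (by simp),
      Pi.single_eq_same, h1, h3, ← map_mul, ← map_mul, ← map_mul]
    congr 1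
    have : k - 1 = l + m := by omega
    rw [this, pow_add]
    calc π ^ l * (e : R) * π ^ m * (u * ((u⁻¹ : Rˣ) * (e⁻¹ : Rˣ) * d))
        = π ^ l * π ^ m * d * (e * (e⁻¹ : Rˣ)) * (u * (u⁻¹ : Rˣ)) := by ring
      _ = π ^ l * π ^ m * d := by rw [Units.mul_inv, Units.mul_inv, mul_one, mul_one]
  have hmem : ∀ y A, A ∈ primVec R P.ι hk1 ↔ A + cls k (π ^ m) • y ∈ primVec R P.ι hk1 := by
    intro y A
    have h0 : proj R hk1 (cls k (π ^ m)) = 0 := by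
      rw [proj_cls, cls_eq_zero hπ, pow_one]
      exact dvd_pow_self _ (by omega)
    simp only [mem_primVec, Pi.add_apply, Pi.smul_apply, smul_eq_mul, map_add, map_mul, h0,
      zero_mul, add_zero]
  -- For each fixed `y`, translation by `π^m y` permutes the primitive vectors, because `m ≥ 1`;
  -- hence each `y` contributes one copy of `T`.
  have key : (Fintype.card (P.ι → Lvl R k) : ℂ) • T =
      ∑ A ∈ primVec R P.ι hk1, ∑ y, gam (MvPolynomial.aeval A P.poly + B A y) := by
    rw [Finset.sum_comm, Nat.cast_smul_eq_nsmul, ← Finset.card_univ, ← Finset.sum_const]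
    refine Finset.sum_congr rfl fun y _ ↦ ?_
    rw [hT]
    symm
    refine Finset.sum_equiv (Equiv.addRight (cls k (π ^ m) • y)) (hmem y) fun A _ ↦ ?_
    rw [← hB]
    rfl
  have hc : (Fintype.card (P.ι → Lvl R k) : ℂ) ≠ 0 := by
    rw [card_fun_lvl, Nat.cast_pow]
    exact pow_ne_zero _ resCard_ne_zero
  refine smul_right_injective _ hc ?_
  simp only
  rw [← smul_mul_assoc, key, Finset.sum_mul]
  refine Finset.sum_congr rfl fun A hA ↦ ?_
  -- `B A` is additive, so the factor `γ^(B A y₀)` is absorbed by the substitution `y ↦ y + y₀`.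
  obtain ⟨y₀, hy₀⟩ := hex A hA
  rw [← hy₀, Finset.sum_mul]
  simp only [gam_mul_gam, add_assoc, ← hBadd]
  exact Fintype.sum_equiv (Equiv.addRight y₀) _ _ fun _ ↦ rfl

theorem mul_scale_zUnif_apply {k : ℕ} {s : R} {X : GrpAlg R k}
    (hX : ∀ d, X * gam (cls k (s * d)) = X) : X * (scale s (zUnif R)).1 k = X := by
  rw [scale_zUnif_apply, mul_smul_comm, Finset.mul_sum, Finset.sum_congr rfl (g := fun _ ↦ X),
    Finset.sum_const, card_univ_lvl, ← Nat.cast_smul_eq_nsmul ℂ, smul_smul, Nat.cast_pow,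
    inv_mul_cancel₀ (pow_ne_zero _ resCard_ne_zero), one_smul]
  intro C _
  obtain ⟨c, rfl⟩ := cls_surjective k C
  exact hX c

/-- Two lifts of a class from level `k` to level `k + 1` differ by a multiple of `π^k`, which
`z^(π^k R)` absorbs. An element fixed by that factor can therefore be recovered from its projection.
-/
theorem eq_of_phi_eq {π : R} (hπ : Irreducible π) {k : ℕ} {X Y : GrpAlg R (k + 1)}
    (hX : X * (scale (π ^ k) (zUnif R)).1 (k + 1) = X)
    (hY : Y * (scale (π ^ k) (zUnif R)).1 (k + 1) = Y)
    (h : phi R (Nat.le_succ k) X = phi R (Nat.le_succ k) Y) : X = Y := by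
  choose s hs using cls_surjective (R := R) k
  set W := (scale (π ^ k) (zUnif R)).1 (k + 1) with hW
  have key : ∀ Z : GrpAlg R (k + 1), Z * W = AddMonoidAlgebra.mapDomain
      (fun C ↦ cls (k + 1) (s C)) (phi R (Nat.le_succ k) Z) * W := by
    intro Z
    induction Z using AddMonoidAlgebra.induction_linear with
    | zero => simp
    | add x y hx hy => rw [add_mul, hx, hy, map_add, AddMonoidAlgebra.mapDomain_add, add_mul]
    | single A c =>
      obtain ⟨a, rfl⟩ := cls_surjective (k + 1) A
      have h1 : phi R (Nat.le_succ k) (AddMonoidAlgebra.single (cls (k + 1) a) c) =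
          AddMonoidAlgebra.single (cls k a) c := by
        simp [phi]
      have h2 : ∀ b : R, (AddMonoidAlgebra.single (cls (k + 1) b) c : GrpAlg R (k + 1)) =
          c • (zPt b).1 (k + 1) := by
        intro b
        rw [zPt_apply]
        simp [gam]
      have h3 : π ^ k ∣ a - s (cls k a) := by
        rw [← cls_eq_zero hπ, cls_sub, hs, sub_self]
      rw [h1, AddMonoidAlgebra.mapDomain_single, h2, h2]
      conv_lhs => rw [show a = s (cls k a) + (a - s (cls k a)) by ring]
      rw [zPt_add, GenAlg.mul_apply, smul_mul_assoc, smul_mul_assoc, mul_assoc, hW,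
        ← GenAlg.mul_apply (zPt (a - _)), zPt_mul_scale_zUnif h3]
  rw [← hX, ← hY, key X, key Y, h]

/-- The head of a unimodular form absorbs `z ^ (π ^ (2ℓ + 1) R)`. -/
theorem head_mul_scale_zUnif {π : R} (hπ : Irreducible π) {l : ℕ} (h2 : Associated (π ^ l) 2)
    {P : QForm R} (hP : P.Unimodular) :
    head P.poly * scale (π ^ (2 * l + 1)) (zUnif R) = head P.poly := by
  refine GenAlg.ext_of_le (2 * l + 1) fun k hk ↦ ?_
  induction k, hk using Nat.le_induction with
  | base =>
    -- At level `2l + 1` the factor is trivial, since `π^(2l+1)` vanishes there.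
    rw [GenAlg.mul_apply, mul_scale_zUnif_apply]
    intro d
    rw [(cls_eq_zero hπ).2 (dvd_mul_right _ d), gam_zero, mul_one]
  | succ k hk ih =>
    -- By `head_mul_gam` the head absorbs `z^(π^k R)` at level `k + 1`. Both sides are then
    -- determined by their projections to level `k`, which agree by induction.
    have h1 : (head P.poly).1 (k + 1) * (scale (π ^ k) (zUnif R)).1 (k + 1) =
        (head P.poly).1 (k + 1) := by
      refine mul_scale_zUnif_apply fun d ↦ ?_
      have := head_mul_gam hπ h2 hP (k := k + 1) (by omega) d
      rwa [Nat.add_sub_cancel] at this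
    refine eq_of_phi_eq hπ ?_ h1 ?_
    · rw [GenAlg.mul_apply, mul_right_comm, h1]
    · rw [(head P.poly * _).2 k (k + 1) (Nat.le_succ k), ih, (head P.poly).2 k (k + 1)]

/-- Insert `z^(π^(2l+1) R)` next to the head; as `s` is a multiple of `π^(2l+1)`, this uniform
factor swallows `F(z^s)` up to its mass. -/
theorem head_mul_scale {π : R} (hπ : Irreducible π) {l : ℕ} (h2 : Associated (π ^ l) 2)
    {P : QForm R} (hP : P.Unimodular) {s : R} (hs : π ^ (2 * l + 1) ∣ s) (F : GenAlg R) :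
    head P.poly * scale s F = mass F • head P.poly := by
  obtain ⟨u, rfl⟩ := hs
  rw [← head_mul_scale_zUnif hπ h2 hP, mul_assoc, ← scale_scale, mul_comm (scale _ (zUnif R)),
    scale_mul_scale_zUnif, mass_scale, mul_smul_comm]

end Head

/-! ### Parity sums and the recursion that divides out `π` -/

noncomputable section Recursion

section Indices

theorem mem_parityIdx {i j : ℕ} : j ∈ parityIdx i ↔ j < i + 1 ∧ j % 2 = i % 2 := by
  rw [parityIdx, Finset.mem_filter, Finset.mem_range]
  rfl

theorem parityIdx_add_two (i : ℕ) : parityIdx (i + 2) = insert (i + 2) (parityIdx i) := by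
  ext j
  simp only [Finset.mem_insert, mem_parityIdx]
  omega

theorem notMem_parityIdx {i j : ℕ} (h : i < j) : j ∉ parityIdx i := by
  simp only [mem_parityIdx]
  omega

theorem parityIdx_zero : parityIdx 0 = {0} := rfl

theorem parityIdx_one : parityIdx 1 = {1} := rfl

theorem parityIdx_disjoint (w : ℕ) : Disjoint (parityIdx w) (parityIdx (w + 1)) := by
  rw [Finset.disjoint_left]
  intro j
  simp only [mem_parityIdx]
  omega

theorem parityIdx_union (w : ℕ) : parityIdx w ∪ parityIdx (w + 1) = Finset.range (w + 2) := by
  ext j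
  simp only [Finset.mem_union, mem_parityIdx, Finset.mem_range]
  omega

variable {R : Type*} [CommRing R] (Q : ℕ → QForm R)

theorem parRank_add_parRank (w : ℕ) :
    parRank Q w + parRank Q (w + 1) = ∑ i ∈ Finset.range (w + 2), (Q i).rank := by
  rw [← parityIdx_union, Finset.sum_union (parityIdx_disjoint w)]
  rfl

/-- The sequence `Q_(i), Q_(i+1), Q_{i+2}, Q_{i+3}, …`. -/
def tupSeq (i j : ℕ) : QForm R := if j ≤ 1 then parSum Q (i + j) else Q (i + j)

theorem tupSeq_zero (i : ℕ) : tupSeq Q i 0 = parSum Q i := rfl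

theorem tupSeq_one (i : ℕ) : tupSeq Q i 1 = parSum Q (i + 1) := rfl

theorem tupSeq_add_two (i j : ℕ) : tupSeq Q i (j + 2) = Q (i + (j + 2)) :=
  if_neg (by omega)

variable {Q} in
theorem unimodular_parSum (hQ : ∀ i, (Q i).Unimodular) (i : ℕ) :
    (parSum Q i).Unimodular := QForm.unimodular_directSum _ _ hQ

theorem rank_parSum (i : ℕ) : (parSum Q i).rank = parRank Q i :=
  QForm.rank_directSum _ _

section Weights

variable [IsLocalRing R]

theorem wt_zero : wt Q 0 0 = 1 := by
  simp [wt, parQ]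

theorem wt_succ_right (i j : ℕ) :
    wt Q i (j + 1) = ((resCard R : ℂ) ^ parRank Q j)⁻¹ • wt Q i j := by
  rw [wt, wt, smul_smul]
  congr 1
  rw [parQ, parQ, Finset.sum_range_succ, pow_add, Nat.cast_mul, mul_inv, mul_comm,
    Nat.cast_pow _ (parRank Q j)]

theorem wt_succ_left (i j : ℕ) : wt Q (i + 1) j = wt Q i j * PowerSeries.X := by
  rw [wt, wt, smul_mul_assoc, pow_succ]

end Weights

end Indices

variable {R : Type*} [CommRing R] [IsDomain R] [IsDiscreteValuationRing R]
  [Finite (ResidueField R)]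

/-- The generating function of a quadratic form. -/
def qGen (P : QForm R) : GenAlg R := genFun P.poly

/-- The head of the generating function of a quadratic form. -/
def qHead (P : QForm R) : GenAlg R := head P.poly

theorem mass_qGen (P : QForm R) : mass (qGen P) = 1 := mass_genFun _

theorem qGen_of_poly_eq_zero {P : QForm R} (h : P.poly = 0) : qGen P = 1 := by
  rw [qGen, h, genFun_zero]

theorem qGen_parSum (Q : ℕ → QForm R) (i : ℕ) :
    qGen (parSum Q i) = ∏ j ∈ parityIdx i, qGen (Q j) :=
  genFun_directSum _ _

theorem qGen_parSum_add_two (Q : ℕ → QForm R) (i : ℕ) :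
    qGen (parSum Q (i + 2)) = qGen (parSum Q i) * qGen (Q (i + 2)) := by
  rw [qGen_parSum, qGen_parSum, parityIdx_add_two,
    Finset.prod_insert (notMem_parityIdx (by omega)), mul_comm]

theorem qGen_tupSeq_zero (Q : ℕ → QForm R) (j : ℕ) : qGen (tupSeq Q 0 j) = qGen (Q j) := by
  match j with
  | 0 => rw [tupSeq_zero, qGen_parSum, parityIdx_zero, Finset.prod_singleton]
  | 1 => rw [tupSeq_one, qGen_parSum, parityIdx_one, Finset.prod_singleton]
  | j + 2 => rw [tupSeq_add_two, zero_add]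

theorem coreProd_eq (π : R) (l : ℕ) (P : Fin (2 * l + 1) → QForm R) (S : ℕ → QForm R)
    (h0 : P 0 = S 0) (h : ∀ j : Fin (2 * l), qGen (P j.succ) = qGen (S (j + 1))) :
    coreProd π l P = qHead (S 0) *
      ∏ j ∈ Finset.range (2 * l), scale (π ^ (j + 1)) (qGen (S (j + 1))) := by
  rw [Finset.prod_range]
  change qHead (P 0) * ∏ j : Fin (2 * l), scale (π ^ (j.val + 1)) (qGen (P j.succ)) = _
  rw [h0]
  simp only [h]

theorem coreProd_tup (π : R) (l : ℕ) (Q : ℕ → QForm R) (i : ℕ) :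
    coreProd π l (tup l Q i) = qHead (tupSeq Q i 0) *
      ∏ j ∈ Finset.range (2 * l), scale (π ^ (j + 1)) (qGen (tupSeq Q i (j + 1))) :=
  coreProd_eq π l _ (tupSeq Q i) rfl fun _ ↦ rfl

/-- `G_{Q_(i)}(z) G_{Q_(i+1)}(z ^ π) G_{Q_{i+2}}(z ^ (π ^ 2)) ⋯`, up to the factor of index `N`. -/
def stage (π : R) (Q : ℕ → QForm R) (N i : ℕ) : GenAlg R :=
  qGen (parSum Q i) * ∏ j ∈ Finset.range N, scale (π ^ (j + 1)) (qGen (tupSeq Q i (j + 1)))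

theorem mass_stage (π : R) (Q : ℕ → QForm R) (N i : ℕ) : mass (stage π Q N i) = 1 := by
  rw [stage, map_mul, map_prod, mass_qGen, one_mul]
  exact Finset.prod_eq_one fun j _ ↦ by rw [mass_scale, mass_qGen]

/-- The parity sums with indices 0 and 1 are `Q_0` and `Q_1`, so the recursion starts at the
original product. The factors beyond `ω` are 1, so a finite `N` can replace the infinite product. -/
theorem stage_zero (π : R) (Q : ℕ → QForm R) {ω N : ℕ} (hQ : ∀ i, ω < i → (Q i).poly = 0)
    (hN : ω ≤ N) :
    stage π Q N 0 = ∏ i ∈ Finset.range (ω + 1), scale (π ^ i) (genFun (Q i).poly) := by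
  have h : ∏ i ∈ Finset.range (ω + 1), scale (π ^ i) (genFun (Q i).poly) =
      ∏ i ∈ Finset.range (N + 1), scale (π ^ i) (qGen (Q i)) := by
    refine Finset.prod_subset (Finset.range_subset_range.2 (by omega)) fun i _ hi ↦ ?_
    rw [Finset.mem_range] at hi
    rw [← qGen, qGen_of_poly_eq_zero (hQ i (by omega)), scale_one]
  rw [h, Finset.prod_range_succ', stage, mul_comm, ← tupSeq_zero, qGen_tupSeq_zero, pow_zero,
    scale_one_left]
  simp only [qGen_tupSeq_zero]

theorem qHead_mul_prod {π : R} (hπ : Irreducible π) {l : ℕ} (h2 : Associated (π ^ l) 2)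
    {P : QForm R} (hP : P.Unimodular) (S : ℕ → QForm R) {N : ℕ} (hN : 2 * l ≤ N) :
    qHead P * ∏ j ∈ Finset.range N, scale (π ^ (j + 1)) (qGen (S j)) =
      qHead P * ∏ j ∈ Finset.range (2 * l), scale (π ^ (j + 1)) (qGen (S j)) := by
  induction N, hN using Nat.le_induction with
  | base => rfl
  | succ N hN ih =>
    rw [Finset.prod_range_succ, mul_comm (∏ j ∈ _, _), ← mul_assoc, qHead,
      head_mul_scale hπ h2 hP (pow_dvd_pow π (by omega : 2 * l + 1 ≤ N + 1)), mass_qGen, one_smul,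
      ← qHead, ih]

theorem coreProd_mul_scale_zUnif {π : R} (hπ : Irreducible π) {l : ℕ}
    (h2 : Associated (π ^ l) 2) {P : Fin (2 * l + 1) → QForm R} (hP : (P 0).Unimodular) {s : R}
    (hs : π ^ (2 * l + 1) ∣ s) :
    coreProd π l P * scale s (zUnif R) = coreProd π l P := by
  rw [coreProd, mul_right_comm, head_mul_scale hπ h2 hP hs, mass_zUnif, one_smul]

/-- The recursion that divides out `π` once. -/
theorem stage_eq {π : R} (hπ : Irreducible π) {l : ℕ} (h2 : Associated (π ^ l) 2)
    {Q : ℕ → QForm R} (hQ : ∀ i, (Q i).Unimodular) {ω N : ℕ}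
    (hQω : ∀ i, ω < i → (Q i).poly = 0) (hN : ω < N) (hlN : 2 * l ≤ N) (i : ℕ) :
    stage π Q N i = coreProd π l (tup l Q i) +
      ((resCard R : ℂ) ^ parRank Q i)⁻¹ • scale π (stage π Q N (i + 1)) := by
  have h0 : qGen (parSum Q i) = qHead (parSum Q i) +
      ((resCard R : ℂ) ^ parRank Q i)⁻¹ • scale (π ^ 2) (qGen (parSum Q i)) := by
    rw [← rank_parSum Q i]
    exact genFun_eq_head_add hπ _
  rw [coreProd_tup, tupSeq_zero,
    ← qHead_mul_prod hπ h2 (unimodular_parSum hQ i) (fun j ↦ tupSeq Q i (j + 1)) hlN]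
  conv_lhs => rw [stage, h0, add_mul, smul_mul_assoc]
  congr 2
  obtain ⟨M, rfl⟩ : ∃ M, N = M + 1 := ⟨N - 1, by omega⟩
  -- The factor `G_{Q_{i+2}}(z^(π^2))` is split off. To keep the product at `M` terms after the
  -- shift of index, a factor beyond `ω`, equal to 1, is appended.
  have h1 : ∏ j ∈ Finset.range M, scale (π ^ (j + 1 + 1)) (qGen (tupSeq Q i (j + 1 + 1))) =
      (∏ j ∈ Finset.range M, scale (π ^ (j + 3)) (qGen (Q (i + (j + 3))))) *
        scale (π ^ 2) (qGen (Q (i + 2))) := by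
    have h2 : scale (π ^ (M + 1 + 1)) (qGen (tupSeq Q i (M + 1 + 1))) = 1 := by
      rw [tupSeq_add_two, qGen_of_poly_eq_zero (hQω _ (by omega)), scale_one]
    rw [← mul_one (∏ j ∈ Finset.range M, _), ← h2,
      ← Finset.prod_range_succ fun j ↦ scale (π ^ (j + 1 + 1)) (qGen (tupSeq Q i (j + 1 + 1))),
      Finset.prod_range_succ']
    simp only [tupSeq_add_two]
  rw [Finset.prod_range_succ', h1, stage, scale_mul, scale_prod, Finset.prod_range_succ']
  simp only [scale_scale, zero_add, pow_one, tupSeq_add_two, tupSeq_one]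
  -- Here `G_{Q_(i)}(z^(π^2))`, left over from the splitting, meets `G_{Q_{i+2}}(z^(π^2))`: together
  -- they are the second factor of the next stage.
  rw [qGen_parSum_add_two, scale_mul, ← pow_two]
  have h3 : ∀ j, scale (π * π ^ (j + 1 + 1)) (qGen (Q (i + 1 + (j + 2)))) =
      scale (π ^ (j + 3)) (qGen (Q (i + (j + 3)))) := by
    intro j
    rw [← pow_succ', show i + 1 + (j + 2) = i + (j + 3) by omega]
  simp only [h3]
  ring

theorem Ig_stage {π : R} (hπ : Irreducible π) {l : ℕ} (h2 : Associated (π ^ l) 2)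
    {Q : ℕ → QForm R} (hQ : ∀ i, (Q i).Unimodular) {ω N : ℕ}
    (hQω : ∀ i, ω < i → (Q i).poly = 0) (hN : ω < N) (hlN : 2 * l ≤ N) (i : ℕ) (E : GenAlg R) :
    Ig (E * stage π Q N i) = Ig (E * coreProd π l (tup l Q i)) +
      ((resCard R : ℂ) ^ parRank Q i)⁻¹ • Ig (E * scale π (stage π Q N (i + 1))) := by
  rw [stage_eq hπ h2 hQ hQω hN hlN, mul_add, Ig_add, mul_smul_comm, Ig_smul]

/-- `n` steps of the recursion for `z ^ (π ^ n (a + b R))`. -/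
theorem Ig_stage_zero {π : R} (hπ : Irreducible π) {l : ℕ} (h2 : Associated (π ^ l) 2)
    {Q : ℕ → QForm R} (hQ : ∀ i, (Q i).Unimodular) {ω N : ℕ}
    (hQω : ∀ i, ω < i → (Q i).poly = 0) (hN : ω < N) (hlN : 2 * l ≤ N) (n : ℕ) (a b : R) :
    Ig (zPt (π ^ n * a) * scale (π ^ n * b) (zUnif R) * stage π Q N 0) =
      ∑ i ∈ Finset.range n, wt Q i i * Ig (zPt (π ^ (n - i) * a) *
          scale (π ^ (n - i) * b) (zUnif R) * coreProd π l (tup l Q i))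
        + wt Q n n * Ig (zPt a * scale b (zUnif R) * stage π Q N n) := by
  induction n generalizing a b with
  | zero => simp [wt_zero]
  | succ n ih =>
    -- After `n` steps one factor `π` is still left in the point and the coset, so one more step is
    -- possible.
    have h := ih (π * a) (π * b)
    rw [← mul_assoc, ← mul_assoc, ← pow_succ] at h
    have hsum : ∀ i ∈ Finset.range n, wt Q i i * Ig (zPt (π ^ (n - i) * (π * a)) *
        scale (π ^ (n - i) * (π * b)) (zUnif R) * coreProd π l (tup l Q i)) =
        wt Q i i * Ig (zPt (π ^ (n + 1 - i) * a) *
        scale (π ^ (n + 1 - i) * b) (zUnif R) * coreProd π l (tup l Q i)) := by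
      intro i hi
      rw [Finset.mem_range] at hi
      rw [← mul_assoc, ← mul_assoc, ← pow_succ, show n - i + 1 = n + 1 - i by omega]
    have hlast : Ig (zPt (π * a) * scale (π * b) (zUnif R) * scale π (stage π Q N (n + 1))) =
        PowerSeries.X * Ig (zPt a * scale b (zUnif R) * stage π Q N (n + 1)) := by
      rw [← Ig_scale_unif hπ, scale_mul, scale_mul, scale_zPt, scale_scale]
    rw [h, Finset.sum_congr rfl hsum, Ig_stage hπ h2 hQ hQω hN hlN, hlast, mul_add,
      Finset.sum_range_succ, add_assoc, show n + 1 - n = 1 by omega, pow_one, wt_succ_right,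
      wt_succ_left, mul_smul_comm, smul_mul_assoc, mul_assoc (wt Q n n) PowerSeries.X]

end Recursion

/-! ### The zeta integral as `Ig` of the generating function -/

section Measure

variable {R : Type*} [CommRing R] [IsDomain R] [IsDiscreteValuationRing R]

open IsDiscreteValuationRing in
theorem addVal_eq_natCast_iff {π : R} (hπ : Irreducible π) {a : R} {n : ℕ} :
    addVal R a = n ↔ Associated (π ^ n) a := by
  have hn : addVal R (π ^ n) = n := by
    rw [addVal_pow, addVal_uniformizer hπ]
    simp
  rw [← hn]
  constructor
  · exact fun h ↦ associated_of_dvd_dvd (addVal_le_iff_dvd.1 h.ge) (addVal_le_iff_dvd.1 h.le)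
  · exact fun h ↦ le_antisymm (addVal_le_iff_dvd.2 h.symm.dvd) (addVal_le_iff_dvd.2 h.dvd)

open IsDiscreteValuationRing in
theorem natCast_le_addVal_iff {π : R} (hπ : Irreducible π) {a : R} {n : ℕ} :
    (n : ℕ∞) ≤ addVal R a ↔ π ^ n ∣ a := by
  have hn : addVal R (π ^ n) = n := by
    rw [addVal_pow, addVal_uniformizer hπ]
    simp
  rw [← hn, addVal_le_iff_dvd]

theorem absVal_eq {π : R} (hπ : Irreducible π) {a : R} {n : ℕ} (h : π ^ n ∣ a)
    (h' : ¬ π ^ (n + 1) ∣ a) : absVal a = ((resCard R : ℝ) ^ n)⁻¹ := by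
  have h0 : a ≠ 0 := by
    rintro rfl
    exact h' (dvd_zero _)
  have h1 : IsDiscreteValuationRing.addVal R a = n := by
    rw [← natCast_le_addVal_iff hπ] at h h'
    refine le_antisymm (ENat.lt_natCast_add_one_iff.1 ?_) h
    simpa using h'
  rw [absVal, if_neg h0, h1, ENat.toNat_natCast]

theorem absVal_cpow {π : R} (hπ : Irreducible π) {a : R} {n : ℕ} (h : π ^ n ∣ a)
    (h' : ¬ π ^ (n + 1) ∣ a) (s : ℂ) :
    ((absVal a : ℝ) : ℂ) ^ s = ((resCard R : ℂ) ^ (-s)) ^ n := by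
  rw [absVal_eq hπ h h', ← inv_pow]
  have h1 : (((resCard R : ℝ)⁻¹ : ℝ) : ℂ) ^ s = (resCard R : ℂ) ^ (-s) := by
    rw [Complex.cpow_neg, Complex.ofReal_inv, Complex.ofReal_natCast, Complex.inv_cpow]
    rw [Complex.natCast_arg]
    exact Real.pi_pos.ne
  rw [← h1]
  have hp : (0 : ℝ) ≤ (resCard R : ℝ)⁻¹ := by positivity
  clear h h'
  -- The power law is proved one factor at a time, since multiplicativity of complex powers is
  -- available for nonnegative real bases.
  induction n with
  | zero => simp
  | succ n ih =>
    rw [pow_succ, Complex.ofReal_mul, Complex.mul_cpow_ofReal_nonneg (by positivity) hp, ih,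
      pow_succ]

theorem cls_eval {σ : Type*} (f : MvPolynomial σ R) (k : ℕ) (x : σ → R) :
    cls k (MvPolynomial.eval x f) = MvPolynomial.aeval (fun h ↦ cls k (x h)) f := by
  rw [← MvPolynomial.coe_aeval_eq_eval]
  exact (MvPolynomial.aeval_algebraMap_apply (Lvl R k) x f).symm

variable {σ : Type*}

theorem setOf_cls_eq_pi (k : ℕ) (A : σ → Lvl R k) :
    {x : σ → R | (fun h ↦ cls k (x h)) = A} = Set.univ.pi fun h ↦ {y | cls k y = A h} := by
  ext x
  rw [Set.mem_univ_pi]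
  exact funext_iff

/-- The vectors at which the value of `f` is divisible by `π ^ k`. -/
def divSet (f : MvPolynomial σ R) (k : ℕ) : Set (σ → R) :=
  {x | cls k (MvPolynomial.eval x f) = 0}

variable [Fintype σ] [Finite (ResidueField R)]

open Classical in
theorem divSet_eq (f : MvPolynomial σ R) (k : ℕ) : divSet f k =
    ⋃ A ∈ Finset.univ.filter (fun A : σ → Lvl R k ↦ MvPolynomial.aeval A f = 0),
      {x : σ → R | (fun h ↦ cls k (x h)) = A} := by
  ext x
  simp only [divSet, Set.mem_ofPred_eq, cls_eval, Set.mem_iUnion, Finset.mem_filter,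
    Finset.mem_univ, true_and, exists_prop, exists_eq_right']

variable [TopologicalSpace R] [IsTopologicalRing R] [CompactSpace R] [T2Space R]

/-- The topology is not assumed to be the `π`-adic one. Compactness and the Hausdorff property
suffice: the ideal is a continuous image of `R`, hence closed, and a closed subgroup of finite index
is open. -/
theorem isOpen_pow_maximalIdeal (k : ℕ) : IsOpen ((maximalIdeal R ^ k : Ideal R) : Set R) := by
  obtain ⟨π, hπ⟩ := IsDiscreteValuationRing.exists_irreducible R
  have h1 : ((maximalIdeal R ^ k : Ideal R) : Set R) = Set.range fun x ↦ π ^ k * x := by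
    ext x
    rw [SetLike.mem_coe, ← Ideal.Quotient.eq_zero_iff_mem]
    exact (cls_eq_zero hπ).trans ⟨fun ⟨y, hy⟩ ↦ ⟨y, hy.symm⟩, fun ⟨y, hy⟩ ↦ ⟨y, hy.symm⟩⟩
  have h2 : IsClosed ((maximalIdeal R ^ k : Ideal R) : Set R) := by
    rw [h1]
    exact (isCompact_range (by fun_prop)).isClosed
  have h3 : (maximalIdeal R ^ k : Ideal R).toAddSubgroup.FiniteIndex :=
    @AddSubgroup.finiteIndex_of_finite_quotient _ _ _ (instFiniteLvl R k)
  exact AddSubgroup.isOpen_of_isClosed_of_finiteIndex (maximalIdeal R ^ k : Ideal R).toAddSubgroup h2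

theorem isOpen_setOf_cls_eq (k : ℕ) (A : Lvl R k) : IsOpen {x : R | cls k x = A} := by
  obtain ⟨a, rfl⟩ := cls_surjective k A
  have h : {x : R | cls k x = cls k a} = (fun x ↦ x - a) ⁻¹' (maximalIdeal R ^ k : Ideal R) := by
    ext x
    exact Ideal.Quotient.eq
  rw [h]
  exact (isOpen_pow_maximalIdeal k).preimage (by fun_prop)

variable [MeasurableSpace R] [BorelSpace R]

/-- The Haar measure on `R` of total mass `1`. -/
noncomputable abbrev haarOne (R : Type*) [CommRing R] [TopologicalSpace R] [IsTopologicalRing R]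
    [CompactSpace R] [MeasurableSpace R] [BorelSpace R] : Measure R :=
  Measure.addHaarMeasure (⊤ : TopologicalSpace.PositiveCompacts R)

instance : IsProbabilityMeasure (haarOne R) :=
  ⟨by simpa using Measure.addHaarMeasure_self (K₀ := (⊤ : TopologicalSpace.PositiveCompacts R))⟩

/-- The `q^k` residue classes are translates of each other and partition a space of mass 1. -/
theorem haarOne_cls_eq (k : ℕ) (A : Lvl R k) :
    haarOne R {x : R | cls k x = A} = ((resCard R : ENNReal) ^ k)⁻¹ := by
  have h1 : ∀ B : Lvl R k, haarOne R {x : R | cls k x = B} = haarOne R {x : R | cls k x = A} := by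
    intro B
    obtain ⟨a, ha⟩ := cls_surjective k (A - B)
    have : {x : R | cls k x = B} = (fun x ↦ a + x) ⁻¹' {x : R | cls k x = A} := by
      ext x
      change cls k x = B ↔ cls k (a + x) = A
      rw [cls_add, ha]
      constructor
      · rintro rfl
        simp
      · intro h
        rw [← sub_eq_zero, ← sub_eq_zero.2 h]
        ring
    rw [this, measure_preimage_add]
  have h2 : (1 : ENNReal) = ∑ B : Lvl R k, haarOne R {x : R | cls k x = B} := by
    rw [← measure_univ (μ := haarOne R), ← measure_biUnion_finset]
    · congr 1
      ext x
      simp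
    · intro B _ C _ hBC
      refine Set.disjoint_left.2 fun x hx hx' ↦ hBC ?_
      exact Eq.trans (Eq.symm hx) hx'
    · exact fun B _ ↦ (isOpen_setOf_cls_eq k B).measurableSet
  rw [Finset.sum_congr rfl fun B _ ↦ h1 B, Finset.sum_const, card_univ_lvl, nsmul_eq_mul,
    mul_comm] at h2
  rw [← Nat.cast_pow]
  exact ENNReal.eq_inv_of_mul_eq_one_left h2.symm

instance : IsProbabilityMeasure (haarPow R σ) :=
  inferInstanceAs (IsProbabilityMeasure (Measure.pi fun _ : σ ↦ haarOne R))

theorem measurableSet_setOf_cls_eq (k : ℕ) (A : σ → Lvl R k) :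
    MeasurableSet {x : σ → R | (fun h ↦ cls k (x h)) = A} := by
  rw [setOf_cls_eq_pi]
  exact MeasurableSet.univ_pi fun h ↦ (isOpen_setOf_cls_eq k (A h)).measurableSet

theorem haarPow_cls_eq (k : ℕ) (A : σ → Lvl R k) :
    haarPow R σ {x : σ → R | (fun h ↦ cls k (x h)) = A} =
      ((resCard R : ENNReal) ^ (Fintype.card σ * k))⁻¹ := by
  rw [setOf_cls_eq_pi]
  refine (Measure.pi_pi (fun _ : σ ↦ haarOne R) _).trans ?_
  rw [Finset.prod_congr rfl fun h _ ↦ haarOne_cls_eq k (A h), Finset.prod_const,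
    Finset.card_univ, ← ENNReal.inv_pow, ← pow_mul, mul_comm]

theorem measurableSet_divSet (f : MvPolynomial σ R) (k : ℕ) : MeasurableSet (divSet f k) := by
  classical
  rw [divSet_eq]
  exact Finset.measurableSet_biUnion _ fun A _ ↦ measurableSet_setOf_cls_eq k A

theorem coeff_genFun (f : MvPolynomial σ R) (k : ℕ) :
    ((genFun f).1 k).coeff 0 = ((haarPow R σ).real (divSet f k) : ℂ) := by
  classical
  have h1 : haarPow R σ (divSet f k) =
      (Finset.univ.filter (fun A : σ → Lvl R k ↦ MvPolynomial.aeval A f = 0)).card *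
        ((resCard R : ENNReal) ^ (Fintype.card σ * k))⁻¹ := by
    rw [divSet_eq, measure_biUnion_finset]
    · rw [Finset.sum_congr rfl fun A _ ↦ haarPow_cls_eq k A, Finset.sum_const, nsmul_eq_mul]
    · intro B _ C _ hBC
      refine Set.disjoint_left.2 fun x hx hx' ↦ hBC ?_
      exact Eq.trans (Eq.symm hx) hx'
    · exact fun B _ ↦ measurableSet_setOf_cls_eq k B
  rw [Measure.real, h1, genFun_apply]
  simp [Finsupp.single_apply, mul_comm]

/-- The sets `D k` on which `v(f(x)) = k` cover everything outside the zeros of `f`, where the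
integrand vanishes. The integrand is `t^k` on `D k`, and `‖t‖ < 1` dominates the series by a
geometric one, so sum and integral can be exchanged. -/
theorem zetaEq_genFun (f : MvPolynomial σ R) : ZetaEq f (Ig (genFun f)) := by
  obtain ⟨π, hπ⟩ := IsDiscreteValuationRing.exists_irreducible R
  intro s hs
  set t := (resCard R : ℂ) ^ (-s) with ht
  have ht1 : ‖t‖ < 1 := by
    rw [ht, Complex.norm_natCast_cpow_of_pos resCard_pos]
    exact Real.rpow_lt_one_of_one_lt_of_neg (by exact_mod_cast one_lt_resCard) (by simpa using hs)
  let D : ℕ → Set (σ → R) := fun k ↦ divSet f k \ divSet f (k + 1)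
  have hD : ∀ k, MeasurableSet (D k) := fun k ↦
    (measurableSet_divSet f k).diff (measurableSet_divSet f (k + 1))
  let F : ℕ → (σ → R) → ℂ := fun k ↦ (D k).indicator fun _ ↦ t ^ k
  have hmem : ∀ x k, x ∈ divSet f k ↔ π ^ k ∣ MvPolynomial.eval x f := fun x k ↦ cls_eq_zero hπ
  have hF : ∀ x, HasSum (fun k ↦ F k x) (zetaIntegrand f s x) := by
    intro x
    by_cases h0 : MvPolynomial.eval x f = 0
    -- Needed because `0 ^ 0 = 1` for complex powers.
    · have hs0 : s ≠ 0 := by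
        rintro rfl
        simp at hs
      have h1 : zetaIntegrand f s x = 0 := by
        rw [zetaIntegrand, absVal, if_pos h0, Complex.ofReal_zero, Complex.zero_cpow hs0]
      have h2 : ∀ k, F k x = 0 := fun k ↦ by
        refine Set.indicator_of_notMem (s := D k) (fun h ↦ h.2 ?_) (fun _ ↦ t ^ k)
        rw [hmem, h0]
        exact dvd_zero _
      simp only [h1, h2, hasSum_zero]
    · obtain ⟨n, hn⟩ := IsDiscreteValuationRing.associated_pow_irreducible h0 hπ
      have hk : ∀ k, π ^ k ∣ MvPolynomial.eval x f ↔ k ≤ n := fun k ↦ by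
        rw [hn.dvd_iff_dvd_right, pow_dvd_pow_iff hπ.ne_zero hπ.not_isUnit]
      have h1 : zetaIntegrand f s x = F n x := by
        have : x ∈ D n := ⟨(hmem x n).2 ((hk n).2 le_rfl), fun h ↦ by
          rw [hmem, hk] at h; omega⟩
        rw [zetaIntegrand, absVal_cpow hπ ((hk n).2 le_rfl) (fun h ↦ by rw [hk] at h; omega)]
        exact (Set.indicator_of_mem this fun _ ↦ t ^ n).symm
      rw [h1]
      have hz : ∀ k, k ≠ n → F k x = 0 := fun k hkn ↦ by
        refine Set.indicator_of_notMem (s := D k) (fun h ↦ hkn ?_) (fun _ ↦ t ^ k)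
        have h2 := h.1
        have h3 := h.2
        rw [hmem, hk] at h2 h3
        omega
      exact hasSum_single n hz
  have hFint : ∀ k, Integrable (F k) (haarPow R σ) := fun k ↦
    (integrable_const (t ^ k)).indicator (hD k)
  -- The integrand is the pointwise limit of the partial sums, which are measurable step functions.
  have hmeas : AEStronglyMeasurable (zetaIntegrand f s) (haarPow R σ) :=
    aestronglyMeasurable_of_tendsto_ae (u := Filter.atTop)
      (f := fun n x ↦ ∑ k ∈ Finset.range n, F k x)
      (fun n ↦ Finset.aestronglyMeasurable_fun_sum _ fun k _ ↦ (hFint k).1)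
      (Filter.Eventually.of_forall fun x ↦ (hF x).tendsto_sum_nat)
  have hbound : ∀ x, ‖zetaIntegrand f s x‖ ≤ 1 := by
    intro x
    have h0 : 0 ≤ absVal (MvPolynomial.eval x f) := by
      rw [absVal]
      split_ifs <;> positivity
    rw [zetaIntegrand, Complex.norm_cpow_eq_rpow_re_of_nonneg h0 hs.ne']
    refine Real.rpow_le_one h0 ?_ hs.le
    rw [absVal]
    split_ifs
    · exact zero_le_one
    · exact inv_le_one_of_one_le₀ (one_le_pow₀ (by exact_mod_cast one_lt_resCard.le))
  have hnorm : ∀ k, ∫ x, ‖F k x‖ ∂(haarPow R σ) ≤ ‖t‖ ^ k := by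
    intro k
    have : ∀ x, ‖F k x‖ ≤ ‖t‖ ^ k := fun x ↦ by
      rw [← norm_pow]
      exact norm_indicator_le_norm_self (fun _ ↦ t ^ k) x
    refine (integral_mono (hFint k).norm (integrable_const _) this).trans ?_
    simp
  have hsum := hasSum_integral_of_summable_integral_norm hFint
    (Summable.of_nonneg_of_le (fun k ↦ integral_nonneg fun _ ↦ norm_nonneg _) hnorm
      (summable_geometric_of_lt_one (norm_nonneg _) ht1))
  refine ⟨Integrable.of_bound hmeas 1 (Filter.Eventually.of_forall hbound), ?_⟩
  have hint : igusaZeta f s = ∫ x, ∑' k, F k x ∂(haarPow R σ) :=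
    integral_congr_ae (Filter.Eventually.of_forall fun x ↦ (hF x).tsum_eq.symm)
  have hterm : ∀ k, PowerSeries.coeff k (Ig (genFun f)) * t ^ k =
      ∫ x, F k x ∂(haarPow R σ) := by
    intro k
    rw [integral_indicator (hD k), setIntegral_const, Ig, PowerSeries.coeff_mk, coeff_genFun,
      coeff_genFun, measureReal_sdiff (fun x hx ↦ ?_) (measurableSet_divSet f (k + 1))]
    · rw [Complex.real_smul, Complex.ofReal_sub]
    · rw [hmem] at hx ⊢
      exact (pow_dvd_pow π (Nat.le_succ k)).trans hx
  rw [hint]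
  simp only [hterm]
  exact hsum

end Measure

/-! ### The four shapes of `L + c` -/

section Cases

variable {R : Type*} [CommRing R]

theorem divPow_eq [IsDomain R] {π u : R} (hπ : Irreducible π) {i n : ℕ} (h : i ≤ n) :
    divPow π (π ^ n * u) i = π ^ (n - i) * u := by
  have h1 : π ^ n = π ^ i * π ^ (n - i) := by rw [← pow_add, Nat.add_sub_cancel' h]
  refine mul_left_cancel₀ (pow_ne_zero i hπ.ne_zero) ?_
  rw [pow_mul_divPow (by rw [h1, mul_assoc]; exact dvd_mul_right _ _), h1, mul_assoc]

variable [IsDomain R] [IsDiscreteValuationRing R] [Finite (ResidueField R)]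

theorem prod_scale_of_forall_eq_zero {m : ℕ} {b : Fin m → R} (hb : ∀ j, b j = 0) :
    ∏ j, scale (b j) (zUnif R) = scale 0 (zUnif R) := by
  rw [scale_zero_zUnif]
  exact Finset.prod_eq_one fun j _ ↦ by rw [hb, scale_zero_zUnif]

theorem prod_scale_of_le_one {m : ℕ} (hm : m ≤ 1) (b : Fin m → R) (j : Fin m) :
    ∏ j, scale (b j) (zUnif R) = scale (b j) (zUnif R) := by
  have : Subsingleton (Fin m) := Fin.subsingleton_iff_le_one.2 hm
  exact Fintype.prod_subsingleton _ j

theorem exists_prod_scale_eq {m : ℕ} (hm : m ≤ 1) {s : R} (b : Fin m → R) (hb : ∀ j, s ∣ b j) :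
    ∃ u, ∏ j, scale (b j) (zUnif R) = scale (s * u) (zUnif R) := by
  rcases isEmpty_or_nonempty (Fin m) with h | ⟨⟨j⟩⟩
  · exact ⟨0, by rw [mul_zero, prod_scale_of_forall_eq_zero fun j ↦ h.elim j]⟩
  · obtain ⟨u, hu⟩ := hb j
    exact ⟨u, by rw [← hu, prod_scale_of_le_one hm b j]⟩

variable {π : R} (hπ : Irreducible π) {l : ℕ} (h2 : Associated (π ^ l) 2)

include hπ

theorem Ig_coreProd_unit_mul (a : R) (P : Fin (2 * l + 1) → QForm R) (n : ℕ) {u : R}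
    (hu : IsUnit u) :
    Ig (zPt a * scale (π ^ n * u) (zUnif R) * coreProd π l P) = igIμ π l n a P := by
  rw [← scale_scale, scale_unit_zUnif hu, ← zCoset_pow hπ]
  rfl

include h2

/-- The head cannot distinguish a coset of `sR` from a point once `v(s) > 2l`. This is why `I_a^μ`
is needed only for `μ ≤ 2l`. -/
theorem Ig_coreProd_of_dvd (a : R) {P : Fin (2 * l + 1) → QForm R} (hP : (P 0).Unimodular) {s : R}
    (hs : π ^ (2 * l + 1) ∣ s) :
    Ig (zPt a * scale s (zUnif R) * coreProd π l P) = igI π l a P := by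
  rw [mul_assoc, mul_comm (scale s _), coreProd_mul_scale_zUnif hπ h2 hP hs]
  rfl

variable {Q : ℕ → QForm R} (hQ : ∀ i, (Q i).Unimodular) {ω : ℕ}
  (hQω : ∀ i, ω < i → (Q i).poly = 0)

include hQ hQω

/-- From index `ω - 1` on, adding 2 to the index adds only zero forms to a parity sum. The stages `ω
- 1` and `ω` thus refer to each other, and eliminating one of them produces the factor `1 - t^2 /
q^r`, with `r = r_(ω-1) + r_(ω)`. -/
theorem Ig_genFun_quadPoly_zero (hω : 0 < ω) {m : ℕ} {b : Fin m → R} (hb : ∀ j, b j = 0) :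
    Ig (genFun (quadPoly π ω Q b 0)) =
      ∑ i ∈ Finset.range (ω - 1), wt Q i i * igI π l 0 (tup l Q i)
          + (wt Q (ω - 1) (ω - 1) * igI π l 0 (tupPair l (parSum Q (ω - 1)) (parSum Q ω))
              + wt Q ω ω * igI π l 0 (tupPair l (parSum Q ω) (parSum Q (ω - 1))))
            * poleFactor R (∑ i ∈ Finset.range (ω + 1), (Q i).rank) := by
  obtain ⟨w, rfl⟩ : ∃ w, ω = w + 1 := ⟨ω - 1, by omega⟩
  rw [Nat.add_sub_cancel]
  obtain ⟨N, hN, hlN⟩ : ∃ N, w + 1 < N ∧ 2 * l ≤ N := ⟨w + 2 + 2 * l, by omega, by omega⟩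
  have hq : ∀ i, w + 1 < i → qGen (Q i) = 1 := fun i hi ↦ qGen_of_poly_eq_zero (hQω i hi)
  have hz : (QForm.zero R).poly = 0 := QForm.zero_poly
  have hI : ∀ P, igI π l 0 P = Ig (coreProd π l P) := fun P ↦ by
    rw [igI, ← zPt, zPt_zero, one_mul]
  have hper : ∀ i, w ≤ i → qGen (parSum Q (i + 2)) = qGen (parSum Q i) := fun i hi ↦ by
    rw [qGen_parSum_add_two, hq _ (by omega), mul_one]
  have hstage : stage π Q N (w + 2) = stage π Q N w := by
    rw [stage, stage, hper w le_rfl]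
    congr 1
    refine Finset.prod_congr rfl fun j _ ↦ ?_
    match j with
    | 0 => rw [zero_add, tupSeq_one, tupSeq_one, ← hper (w + 1) (by omega)]
    | j + 1 =>
      rw [tupSeq_add_two, tupSeq_add_two, hq _ (by omega), hq _ (by omega)]
  have htup : ∀ i A, w ≤ i → qGen A = qGen (parSum Q (i + 1)) →
      coreProd π l (tupPair l (parSum Q i) A) = coreProd π l (tup l Q i) := by
    intro i A hi hA
    rw [coreProd_tup]
    refine coreProd_eq π l _ (tupSeq Q i) rfl fun j ↦ ?_
    obtain ⟨j, hj⟩ := j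
    match j with
    | 0 => exact hA
    | j + 1 =>
      have h1 : tupPair l (parSum Q i) A (Fin.succ ⟨j + 1, hj⟩) = QForm.zero R := by
        simp [tupPair]
      rw [h1, qGen_of_poly_eq_zero hz, tupSeq_add_two, hq _ (by omega)]
  have h0 := Ig_stage_zero hπ h2 hQ hQω hN hlN w 0 0
  simp only [mul_zero, zPt_zero, scale_zero_zUnif, one_mul] at h0
  have h1 := Ig_stage hπ h2 hQ hQω hN hlN w 1
  have h3 := Ig_stage hπ h2 hQ hQω hN hlN (w + 1) 1
  rw [one_mul, one_mul, one_mul, Ig_scale_unif hπ] at h1 h3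
  -- Periodicity closes the system: `h1` and `h3` are two equations for the unknown series of stages
  -- `w` and `w + 1`.
  rw [hstage] at h3
  rw [genFun_quadPoly, prod_scale_of_forall_eq_zero hb, zPt_zero, scale_zero_zUnif, one_mul,
    one_mul, ← stage_zero π Q hQω hN.le, h0]
  simp only [hI]
  rw [htup w _ le_rfl rfl, htup (w + 1) _ (by omega) (hper w le_rfl).symm]
  congr 1
  set c := ((resCard R : ℂ) ^ (∑ i ∈ Finset.range (w + 2), (Q i).rank))⁻¹ with hc
  have hcc : c = ((resCard R : ℂ) ^ parRank Q w)⁻¹ * ((resCard R : ℂ) ^ parRank Q (w + 1))⁻¹ := by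
    rw [hc, ← parRank_add_parRank, pow_add, mul_inv]
  have hne : PowerSeries.constantCoeff (1 - c • (PowerSeries.X ^ 2 : PowerSeries ℂ)) ≠ 0 := by
    simp [PowerSeries.smul_eq_C_mul]
  rw [poleFactor, PowerSeries.eq_mul_inv_iff_mul_eq hne, wt_succ_right, wt_succ_left, hcc]
  rw [h3] at h1
  simp only [PowerSeries.smul_eq_C_mul, map_mul] at h1 ⊢
  linear_combination wt Q w w * h1

/-- As `b` divides `c`, the constant is absorbed by `z^(bR)`. After `lam` steps the linear factor is
`z^R`, which absorbs the whole stage and leaves `Ig(z^R)`. The sum is cut where the valuation `lam -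
i` of the remaining coefficient drops to `2l`. -/
theorem Ig_genFun_quadPoly_lin {m : ℕ} (hm : m ≤ 1) {b : Fin m → R} {c : R} {j : Fin m} {lam : ℕ}
    (hb : Associated (π ^ lam) (b j)) (hc : π ^ lam ∣ c) :
    Ig (genFun (quadPoly π ω Q b c)) =
      ∑ i ∈ Finset.range (lam - 2 * l), wt Q i i * igI π l 0 (tup l Q i)
          + ∑ i ∈ Finset.Ico (lam - 2 * l) lam, wt Q i i * igIμ π l (lam - i) 0 (tup l Q i)
          + wt Q lam lam * linZeta R := by
  obtain ⟨N, hN, hlN⟩ : ∃ N, ω < N ∧ 2 * l ≤ N := ⟨ω + 1 + 2 * l, by omega, by omega⟩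
  obtain ⟨u, hu⟩ := hb
  have h0 := Ig_stage_zero hπ h2 hQ hQω hN hlN lam 0 1
  rw [mul_zero, zPt_zero, one_mul, mul_one, scale_one_left, one_mul, mul_comm (zUnif R),
    mul_zUnif, mass_stage, one_smul, Ig_zUnif] at h0
  rw [genFun_quadPoly, prod_scale_of_le_one hm b j, ← hu, ← scale_scale, scale_unit_zUnif u.isUnit,
    zPt_mul_scale_zUnif hc, ← stage_zero π Q hQω hN.le, h0,
    ← Finset.sum_range_add_sum_Ico _ (Nat.sub_le lam (2 * l))]
  simp only [mul_zero]
  refine congrArg₂ (· + ·) (congrArg₂ (· + ·) (Finset.sum_congr rfl fun i hi ↦ ?_)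
    (Finset.sum_congr rfl fun i hi ↦ ?_)) rfl
  · rw [Finset.mem_range] at hi
    rw [Ig_coreProd_of_dvd hπ h2 0 (P := tup l Q i) (unimodular_parSum hQ i)
      (by rw [mul_one]; exact pow_dvd_pow π (by omega))]
  · rw [Ig_coreProd_unit_mul hπ _ _ _ isUnit_one]

/-- Common core of the two cases with `v(c) < v(b)`. After `κ` steps the constant is the unit `u`,
while the coefficient of the linear form is still divisible by `π`. One more splitting yields a head
term and a rest with unit values, which contributes only its mass. With `s = 0` this covers `L = 0`.
-/
theorem Ig_genFun_quadPoly_const {m : ℕ} {b : Fin m → R} {s u : R} {κ : ℕ}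
    (hb : ∏ j, scale (b j) (zUnif R) = scale (π ^ κ * (π * s)) (zUnif R)) (hu : IsUnit u) :
    Ig (genFun (quadPoly π ω Q b (π ^ κ * u))) =
      ∑ i ∈ Finset.range (κ + 1), wt Q i i * Ig (zPt (divPow π (π ^ κ * u) i) *
        scale (π ^ (κ - i) * (π * s)) (zUnif R) * coreProd π l (tup l Q i)) + wt Q κ (κ + 1) := by
  obtain ⟨N, hN, hlN⟩ : ∃ N, ω < N ∧ 2 * l ≤ N := ⟨ω + 1 + 2 * l, by omega, by omega⟩
  have h1 : Ig (zPt u * scale (π * s) (zUnif R) * scale π (stage π Q N (κ + 1))) = 1 := by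
    rw [← scale_scale, mul_assoc, ← scale_mul, Ig_zPt_mul_scale hπ hu, map_mul, mass_scale,
      mass_zUnif, mass_stage, one_mul, one_smul]
  rw [genFun_quadPoly, hb, ← stage_zero π Q hQω hN.le, Ig_stage_zero hπ h2 hQ hQω hN hlN,
    Ig_stage hπ h2 hQ hQω hN hlN, h1, mul_add, ← add_assoc, wt_succ_right, mul_smul_comm, mul_one,
    Finset.sum_range_succ, divPow_eq hπ le_rfl, Nat.sub_self, pow_zero, one_mul, one_mul]
  refine congrArg₂ (· + ·) (congrArg₂ (· + ·) (Finset.sum_congr rfl fun i hi ↦ ?_) rfl) rfl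
  rw [divPow_eq hπ (Finset.mem_range.1 hi).le]

theorem Ig_genFun_quadPoly_near {m : ℕ} (hm : m ≤ 1) {b : Fin m → R} {c : R} {j : Fin m}
    {lam κ : ℕ} (hb : Associated (π ^ lam) (b j)) (hc : Associated (π ^ κ) c) (h : κ < lam)
    (h' : lam ≤ κ + 2 * l) :
    Ig (genFun (quadPoly π ω Q b c)) =
      ∑ i ∈ Finset.range (lam - 2 * l), wt Q i i * igI π l (divPow π c i) (tup l Q i)
          + ∑ i ∈ Finset.Icc (lam - 2 * l) κ,
              wt Q i i * igIμ π l (lam - i) (divPow π c i) (tup l Q i)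
          + wt Q κ (κ + 1) := by
  obtain ⟨u, hu⟩ := hc
  obtain ⟨v, hv⟩ := hb
  -- `d` is the valuation of `b / π^(κ+1)`, so that after `i` steps the coefficient has valuation `κ
  -- - i + 1 + d = lam - i`.
  obtain ⟨d, rfl⟩ : ∃ d, lam = κ + 1 + d := ⟨lam - (κ + 1), by omega⟩
  have hpow : π ^ κ * (π * (π ^ d * v)) = b j := by rw [← hv]; ring
  rw [← hu, Ig_genFun_quadPoly_const hπ h2 hQ hQω
    (by rw [hpow]; exact prod_scale_of_le_one hm b j) u.isUnit,
    ← Finset.sum_range_add_sum_Ico _ (show κ + 1 + d - 2 * l ≤ κ + 1 by omega),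
    Finset.Ico_add_one_right_eq_Icc]
  refine congrArg₂ (· + ·) (congrArg₂ (· + ·) (Finset.sum_congr rfl fun i hi ↦ ?_)
    (Finset.sum_congr rfl fun i hi ↦ ?_)) rfl
  · rw [Finset.mem_range] at hi
    rw [Ig_coreProd_of_dvd hπ h2 _ (P := tup l Q i) (unimodular_parSum hQ i)]
    rw [← mul_assoc, ← mul_assoc, ← pow_succ, ← pow_add]
    exact (pow_dvd_pow π (by omega)).mul_right _
  · rw [Finset.mem_Icc] at hi
    rw [← mul_assoc, ← mul_assoc, ← pow_succ, ← pow_add,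
      Ig_coreProd_unit_mul hπ _ _ _ v.isUnit, show κ - i + 1 + d = κ + 1 + d - i by omega]

/-- For every `i ≤ κ` the remaining coefficient has valuation above `2l`, so each head absorbs the
linear form entirely. -/
theorem Ig_genFun_quadPoly_far {m : ℕ} (hm : m ≤ 1) {b : Fin m → R} {c : R} {κ : ℕ}
    (hc : Associated (π ^ κ) c) (hb : ∀ j, π ^ (κ + 2 * l + 1) ∣ b j) :
    Ig (genFun (quadPoly π ω Q b c)) =
      ∑ i ∈ Finset.range (κ + 1), wt Q i i * igI π l (divPow π c i) (tup l Q i)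
          + wt Q κ (κ + 1) := by
  obtain ⟨u, hu⟩ := hc
  obtain ⟨s, hs⟩ := exists_prod_scale_eq hm b hb
  have hpow : π ^ κ * (π * (π ^ (2 * l) * s)) = π ^ (κ + 2 * l + 1) * s := by ring
  rw [← hu, Ig_genFun_quadPoly_const hπ h2 hQ hQω (hs.trans (by rw [hpow])) u.isUnit]
  refine congrArg₂ (· + ·) (Finset.sum_congr rfl fun i hi ↦ ?_) rfl
  rw [Ig_coreProd_of_dvd hπ h2 _ (P := tup l Q i) (unimodular_parSum hQ i)]
  rw [← mul_assoc π, ← pow_succ']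
  exact (dvd_mul_right _ _).mul_left _

end Cases

theorem t2Space_of_isNonarchimedeanLocalField (K : Type*) [Field K] [ValuativeRel K]
    [TopologicalSpace K] [IsNonarchimedeanLocalField K] : T2Space K := by
  let := IsTopologicalAddGroup.rightUniformSpace K
  have := isUniformAddGroup_of_addCommGroup (G := K)
  infer_instance

end QuadZeta

/-! ### The theorem over the valuation ring of a local field -/

open QuadZeta IsDiscreteValuationRing in
theorem mainTheorem4 {K : Type*} [Field K] [ValuativeRel K] [TopologicalSpace K]
    [IsNonarchimedeanLocalField K] [CharZero K] [MeasurableSpace K] [BorelSpace K]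
    (π : 𝒪[K]) (hπ : Irreducible π)
    (l : ℕ) (hl : addVal 𝒪[K] 2 = l)
    (Q : ℕ → QForm 𝒪[K]) (hQ : ∀ i, (Q i).Unimodular)
    (ω : ℕ) (hω : 0 < ω) (hQω : ∀ i, ω < i → (Q i).poly = 0)
    (m : ℕ) (hm : m ≤ 1) (b : Fin m → 𝒪[K]) (c : 𝒪[K]) :
    -- the case `L = 0` and `c = 0`
    ((∀ j, b j = 0) → c = 0 →
      ZetaEq (quadPoly π ω Q b c)
        (∑ i ∈ Finset.range (ω - 1), wt Q i i * igI π l 0 (tup l Q i)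
          + (wt Q (ω - 1) (ω - 1) * igI π l 0 (tupPair l (parSum Q (ω - 1)) (parSum Q ω))
              + wt Q ω ω * igI π l 0 (tupPair l (parSum Q ω) (parSum Q (ω - 1))))
            * poleFactor 𝒪[K] (∑ i ∈ Finset.range (ω + 1), (Q i).rank))) ∧
    -- the case `L = b x` with `v(b) = lam ≤ v(c)`
    (∀ (j : Fin m) (lam : ℕ), addVal 𝒪[K] (b j) = lam → lam ≤ addVal 𝒪[K] c →
      ZetaEq (quadPoly π ω Q b c)
        (∑ i ∈ Finset.range (lam - 2 * l), wt Q i i * igI π l 0 (tup l Q i)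
          + ∑ i ∈ Finset.Ico (lam - 2 * l) lam, wt Q i i * igIμ π l (lam - i) 0 (tup l Q i)
          + wt Q lam lam * linZeta 𝒪[K])) ∧
    -- the case `L = b x` with `v(c) = κ < v(b) = lam ≤ κ + 2 ℓ`
    (∀ (j : Fin m) (lam κ : ℕ), addVal 𝒪[K] (b j) = lam → addVal 𝒪[K] c = κ →
      κ < lam → lam ≤ κ + 2 * l →
      ZetaEq (quadPoly π ω Q b c)
        (∑ i ∈ Finset.range (lam - 2 * l), wt Q i i * igI π l (divPow π c i) (tup l Q i)
          + ∑ i ∈ Finset.Icc (lam - 2 * l) κ,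
              wt Q i i * igIμ π l (lam - i) (divPow π c i) (tup l Q i)
          + wt Q κ (κ + 1))) ∧
    -- the case `v(b) > v(c) + 2 ℓ` with `v(c) = κ`, which includes `L = 0`, `c ≠ 0`
    (∀ κ : ℕ, addVal 𝒪[K] c = κ → (∀ j, addVal 𝒪[K] c + 2 * l < addVal 𝒪[K] (b j)) →
      ZetaEq (quadPoly π ω Q b c)
        (∑ i ∈ Finset.range (κ + 1), wt Q i i * igI π l (divPow π c i) (tup l Q i)
          + wt Q κ (κ + 1))) := by
  -- The Hausdorff property makes the compact ideals `π^k R` closed, hence open and measurable.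
  have := t2Space_of_isNonarchimedeanLocalField K
  have h2 : Associated (π ^ l) 2 := (addVal_eq_natCast_iff hπ).1 hl
  refine ⟨fun hb hc ↦ ?_, fun j lam hb hc ↦ ?_, fun j lam κ hb hc h h' ↦ ?_, fun κ hc hb ↦ ?_⟩
  · subst hc
    rw [← Ig_genFun_quadPoly_zero hπ h2 hQ hQω hω hb]
    exact zetaEq_genFun _
  · rw [← Ig_genFun_quadPoly_lin hπ h2 hQ hQω hm ((addVal_eq_natCast_iff hπ).1 hb)
      ((natCast_le_addVal_iff hπ).1 hc)]
    exact zetaEq_genFun _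
  · rw [← Ig_genFun_quadPoly_near hπ h2 hQ hQω hm ((addVal_eq_natCast_iff hπ).1 hb)
      ((addVal_eq_natCast_iff hπ).1 hc) h h']
    exact zetaEq_genFun _
  · rw [← Ig_genFun_quadPoly_far hπ h2 hQ hQω hm ((addVal_eq_natCast_iff hπ).1 hc) fun j ↦ ?_]
    · exact zetaEq_genFun _
    · rw [← natCast_le_addVal_iff hπ]
      have h1 := hb j
      rw [hc] at h1
      push_cast
      exact Order.add_one_le_of_lt h1
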